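/- Setting. Secondary storage consists of arrays of words cut into blocks of $B\ge 1$ consecutive words; reading or writing one block costs one I/O; the main memory has $M$ words. $Q$ is a fixed full conjunctive query (a join without projection) with $m$ body atoms over variables $x_1,\dots,x_n$ in a fixed key order; the variables of each atom are distinct and listed in key order, every atom has at least one variable, and every variable occurs in some atom. An input $I$ assigns a finite relation over $\mathbb N$ to each relation symbol of $Q$; $|I|$ is the total number of tuples of these relations and $K$ is the number of output tuples $|Q(I)|$. Each relation is stored as a TrieArray: the levels of its prefix tree in lexicographic order, as one value array per level, together with index arrays that point from each node to the range of its children. The slice of a relation $R$ for a prefix tuple $s$ from $l$ to $h$ is the set of tuples of $R$ that begin with $s$ and whose next component lies in $[l,h]$; its size is the number of words of its value and index arrays. *Probing* determines, by binary search on the arrays, the maximal $h\ge l$ (possibly $\infty$) such that the slice takes at most a given number of blocks, or reports a spill if already the slice from $l$ to $l$ is too large. *Provisioning* copies a slice into memory, by copying contiguous array sections. Boxed Leapfrog Triejoin (LFTJ) reserves one block for the output buffer and divides the other $\lfloor M/B\rfloor-1$ blocks evenly among the $n$ dimensions. At dimension $i$ (starting with $i=1$) it handles the atoms whose first variable is $x_i$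 and the atoms spilled earlier whose next variable is $x_i$. It starts with $l$ equal to the least value and repeats the following: probe these atoms from $l$ with equal shares of the memory of dimension $i$ (its budget plus what the previous dimension left over); let $h$ be the least bound obtained, or $h=l$ if some atom spills; provision the slices from $l$ to $h$ of the atoms that do not spill; hand each spilled atom, with its prefix extended by $l$, over to the dimension of its next variable; treat dimension $i+1$ recursively (after the last dimension: run in-memory Leapfrog Triejoin on the provisioned slices and append the results to the output through the buffer); stop if $h=\infty$, otherwise set $l$ to $h+1$. Statement. For every query $Q$ and every real $c$ there is a constant $C$ (depending only on $Q$ and $c$) such that for all $M$, $B\ge 1$ and all inputs $I$ with $|I|\ge 2$, with $\lfloor M/B\rfloor>nm$ (so that each atom is allotted at least one block of memory), with $\ln|I|\le |I|/B$, and with $|I|\le c\,M$, boxed LFTJ for $Q$ on $I$ terminates, and its total number of block I/Os (reads for probing and provisioning, and writes of the output) is at most $$C\left(\frac{|I|}{B}+\frac{K}{B}\right).$$ -/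

import Mathlib

open Filter

namespace BoxedLFTJ

/-! ## External-memory programs

Secondary storage holds named arrays of words ("files"), each cut into blocks of `B` consecutive
words.  A program can learn about the stored data only by reading blocks. -/

/-- Programs over files named by `F`, returning a value in `α`. -/
inductive Prog (F : Type) (α : Type) : Type where
  /-- stop and return a value -/
  | pure (a : α)
  /-- abort: the step budget of a loop has run out, or the memory is too small for the query -/
  | fail
  /-- read block number `k` of the file `f` -/
  | read (f : F) (k : ℕ) (next : List ℕ → Prog F α)
  /-- append a block to the output file -/
  | write (blk : List ℕ) (next : Prog F α)

namespace Prog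

variable {F α β : Type}

def bind : Prog F α → (α → Prog F β) → Prog F β
  | pure a, g => g a
  | fail, _ => fail
  | read f k next, g => read f k (fun w => (next w).bind g)
  | write blk next, g => write blk (next.bind g)

instance : Monad (Prog F) where
  pure := Prog.pure
  bind := Prog.bind

/-- Number of block transfers (reads and writes) of a run with block size `B` on the given storage;
`none` if the run aborts or tries to write more than `B` words at once. -/
def cost (B : ℕ) (disk : F → List ℕ) : Prog F α → Option ℕ
  | pure _ => some 0
  | fail => none
  | read f k next => (cost B disk (next (((disk f).drop (k * B)).take B))).map (· + 1)
  | write blk next => if blk.length ≤ B then (cost B disk next).map (· + 1) else none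

/-- Run a list of programs one after the other. -/
def seq : List (Prog F α) → Prog F (List α)
  | [] => pure []
  | p :: ps => do
      let a ← p
      let as ← seq ps
      return a :: as

/-- `repeat body until finished`, aborting after `fuel` rounds.  The body returns `Sum.inl` of the
next loop state, or `Sum.inr` of the result when the loop is finished. -/
def repeatUntil (body : α → Prog F (α ⊕ β)) : ℕ → α → Prog F β
  | 0, _ => fail
  | fuel + 1, s => do
      match ← body s with
      | Sum.inl s' => repeatUntil body fuel s'
      | Sum.inr b => return b

/-- Read the word at position `i` of the file `f`. -/
def readWord (B : ℕ) (f : F) (i : ℕ) : Prog F ℕ :=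
  read f (i / B) (fun w => pure (w.getD (i % B) 0))

/-- Read the words at positions `lo, …, hi - 1` of `f`, each block that meets this range once. -/
def readRange (B : ℕ) (f : F) (lo hi : ℕ) : Prog F (List ℕ) :=
  if lo < hi then do
    let blks ← seq ((List.range' (lo / B) ((hi - 1) / B - lo / B + 1)).map
      (fun k => read f k (fun w => pure w)))
    return (blks.flatten.drop (lo % B)).take (hi - lo)
  else return []

/-- Binary search: the least position `p` in `[lo, hi)` where the monotone test `P` succeeds,
and `hi` if there is none. -/
def bsearch (P : ℕ → Prog F Bool) (lo hi : ℕ) : Prog F ℕ :=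
  if lo < hi then do
    if ← P ((lo + hi) / 2) then bsearch P lo ((lo + hi) / 2)
    else bsearch P ((lo + hi) / 2 + 1) hi
  else return lo
termination_by hi - lo
decreasing_by all_goals omega

/-- Append words to the output through a buffer that is written out whenever it holds a full block.
Returns the new content of the buffer. -/
def appendOut (B : ℕ) (buf : List ℕ) : List ℕ → Prog F (List ℕ)
  | [] => return buf
  | w :: ws =>
      if B ≤ buf.length + 1 then write (buf ++ [w]) (appendOut B [] ws)
      else appendOut B (buf ++ [w]) ws

/-- Write out what is left in the output buffer. -/
def flushOut (buf : List ℕ) : Prog F Unit :=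
  if buf = [] then return () else write buf (return ())

end Prog

/-! ## Queries and their answers -/

/-- A full conjunctive query with variables `x₀, …, x_{n-1}` (listed in key order) and `m` body
atoms over relation symbols `0, …, r-1`; the `j`-th atom is `rel j (x_{vars j 0}, x_{vars j 1}, …)`.
In every atom the variables are distinct and follow the key order, every variable occurs in the
body, and every relation symbol is used. -/
structure Query where
  n : ℕ
  m : ℕ
  r : ℕ
  arity : Fin r → ℕ
  arity_pos : ∀ s, 0 < arity s
  rel : Fin m → Fin r
  vars : (j : Fin m) → Fin (arity (rel j)) → Fin n
  vars_strictMono : ∀ j, StrictMono (vars j)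
  vars_cover : ∀ x : Fin n, ∃ j p, vars j p = x
  rel_surj : Function.Surjective rel

namespace Query

variable (Q : Query)

/-- An input: a finite relation of the right arity for every relation symbol. -/
abbrev Input : Type := (s : Fin Q.r) → Finset (Fin (Q.arity s) → ℕ)

/-- `|I|`, the combined number of tuples of the input relations. -/
def inputSize (I : Q.Input) : ℕ := ∑ s, (I s).card

/-- The answer of the query on `I`: all assignments that satisfy every body atom. -/
def answer (I : Q.Input) : Set (Fin Q.n → ℕ) :=
  {t | ∀ j, (fun p => t (Q.vars j p)) ∈ I (Q.rel j)}

/-- `K`, the number of output tuples. -/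
noncomputable def outputSize (I : Q.Input) : ℕ := (Q.answer I).ncard

/-- The variables of atom `j`, as a list of numbers. -/
def atomVars (j : Fin Q.m) : List ℕ := List.ofFn (fun p => (Q.vars j p : ℕ))

end Query

/-! ## TrieArrays -/

/-- The nodes at level `k` of the trie of a relation (a set of tuples): its distinct prefixes of
length `k + 1`, in lexicographic order. -/
def trieNodes (R : Finset (List ℕ)) (k : ℕ) : List (List ℕ) :=
  (R.image (List.take (k + 1))).sort (· ≤ ·)

/-- The value array of level `k`: the labels of the nodes of that level. -/
def valArray (R : Finset (List ℕ)) (k : ℕ) : List ℕ :=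
  (trieNodes R k).map (fun p => p.getD k 0)

/-- The index array of level `k`: the children of the node at position `j` of level `k` occupy the
positions `idx[j], …, idx[j+1] - 1` of level `k + 1`. -/
def idxArray (R : Finset (List ℕ)) (k : ℕ) : List ℕ :=
  (List.range ((trieNodes R k).length + 1)).map fun j =>
    ((trieNodes R (k + 1)).filter
      (fun q => decide (q.take (k + 1) ∈ (trieNodes R k).take j))).length

/-- The files on secondary storage: value and index arrays of the relations. -/
inductive File (r : ℕ) : Type where
  | val (s : Fin r) (k : ℕ)
  | idx (s : Fin r) (k : ℕ)

/-- The relation of symbol `s` as a set of lists. -/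
def Query.tuples (Q : Query) (I : Q.Input) (s : Fin Q.r) : Finset (List ℕ) :=
  (I s).image List.ofFn

/-- Secondary storage with the TrieArrays of the input relations. -/
def Query.disk (Q : Query) (I : Q.Input) : File Q.r → List ℕ
  | .val s k => valArray (Q.tuples I s) k
  | .idx s k => idxArray (Q.tuples I s) k

/-! ## Probing and provisioning slices

A slice of a relation at level `k` for a `k`-tuple `pre` from `l` to `h` consists of the tuples that
start with `pre` and whose next component lies in `[l, h]`.  The domain of values is `ℕ`, so `0`
plays the role of `-∞`, and `⊤ : WithTop ℕ` that of `∞`.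

In what follows `s` is a relation symbol, `a` its arity and `N` the length of its first value array
(the only information on the data that is not read from secondary storage). -/

section Slices

variable {r : ℕ} (B : ℕ) (s : Fin r) (a N : ℕ)

/-- Starting with the position range `[lo, hi)` of level `k`, follow `pre` down the trie by binary
searches.  Returns the range of positions of the children of the node reached, an empty range if
there is no such node. -/
def locate : (k lo hi : ℕ) → (pre : List ℕ) → Prog (File r) (ℕ × ℕ)
  | _, lo, hi, [] => return (lo, hi)
  | k, lo, hi, v :: pre => do
      let p ← Prog.bsearch
        (fun q => do let w ← Prog.readWord B (.val s k) q; return decide (v ≤ w)) lo hi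
      if p < hi then
        let w ← Prog.readWord B (.val s k) p
        if w = v then
          let lo' ← Prog.readWord B (.idx s k) p
          let hi' ← Prog.readWord B (.idx s k) (p + 1)
          locate (k + 1) lo' hi' pre
        else return (0, 0)
      else return (0, 0)

/-- Number of words in the arrays of the slice that consists of the positions `[p, q)` of level `k`
with everything below them, when `d` levels (`k` included) remain. -/
def sliceWords : (d k p q : ℕ) → Prog (File r) ℕ
  | 0, _, _, _ => return 0
  | 1, _, p, q => return q - p
  | d + 2, k, p, q => do
      let p' ← Prog.readWord B (.idx s k) p
      let q' ← Prog.readWord B (.idx s k) q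
      let rest ← sliceWords (d + 1) (k + 1) p' q'
      return (q - p) + (q - p + 1) + rest

/-- The maximal `h ≥ l` such that the slice for `pre` from `l` to `h` takes at most `mem` blocks;
`none` stands for `SPILL`: there is no such `h`. -/
def probe (pre : List ℕ) (l mem : ℕ) : Prog (File r) (Option (WithTop ℕ)) := do
  let k := pre.length
  let (lo, hi) ← locate B s 0 0 N pre
  let p ← Prog.bsearch
    (fun q => do let w ← Prog.readWord B (.val s k) q; return decide (l ≤ w)) lo hi
  let q ← Prog.bsearch
    (fun q => do let w ← sliceWords B s (a - k) k p (q + 1); return decide (mem * B < w)) p hi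
  if q < hi then
    let v ← Prog.readWord B (.val s k) q
    if v ≤ l then return none else return some ((v - 1 : ℕ) : WithTop ℕ)
  else return some ⊤

/-- One level of a slice in memory: a section of a value array, which starts at position `start` of
the stored array, and the matching section of the index array (empty at the last level). -/
structure Level where
  start : ℕ
  vals : List ℕ
  idxs : List ℕ

/-- Copy the positions `[p, q)` of level `k`, and everything below them, into memory. -/
def copyLevels : (d k p q : ℕ) → Prog (File r) (List Level)
  | 0, _, _, _ => return []
  | 1, k, p, q => do
      let vs ← Prog.readRange B (.val s k) p q
      return [⟨p, vs, []⟩]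
  | d + 2, k, p, q => do
      let vs ← Prog.readRange B (.val s k) p q
      let is ← Prog.readRange B (.idx s k) p (q + 1)
      let rest ← copyLevels (d + 1) (k + 1) (is.getD 0 0) (is.getD (q - p) 0)
      return ⟨p, vs, is⟩ :: rest

/-- The tuples represented by a slice in memory, below the positions `[lo, hi)` of its first
level, in lexicographic order.  Positions in the index arrays refer to the stored arrays and are
adapted by the offset `start`. -/
def decode : List Level → (lo hi : ℕ) → List (List ℕ)
  | [], _, _ => [[]]
  | L :: Ls, lo, hi => (List.range' lo (hi - lo)).flatMap fun p =>
      (decode Ls (L.idxs.getD (p - L.start) 0) (L.idxs.getD (p + 1 - L.start) 0)).map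
        (fun t => L.vals.getD (p - L.start) 0 :: t)

/-- Load the slice for `pre` from `l` to `h` into memory.  Returns its tuples, in lexicographic
order, and the number of blocks of memory that it takes. -/
def provision (pre : List ℕ) (l : ℕ) (h : WithTop ℕ) : Prog (File r) (List (List ℕ) × ℕ) := do
  let k := pre.length
  let (lo, hi) ← locate B s 0 0 N pre
  let p ← Prog.bsearch
    (fun q => do let w ← Prog.readWord B (.val s k) q; return decide (l ≤ w)) lo hi
  let q ← Prog.bsearch
    (fun q => do let w ← Prog.readWord B (.val s k) q; return decide (h < (w : WithTop ℕ))) p hi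
  if p < q then
    let Ls ← copyLevels B s (a - k) k p q
    let words := (Ls.map (fun L => L.vals.length + L.idxs.length)).sum
    return ((decode Ls p q).map (fun t => pre ++ t), (words + B - 1) / B)
  else return ([], 0)

end Slices

/-! ## Leapfrog Triejoin in memory -/

/-- The search loop of the leapfrog join.  The lists are the remaining values of the (cyclically
arranged) linear iterators, the current one first; the last one has the largest value. -/
def lfSearch : ℕ → List (List ℕ) → List ℕ
  | 0, _ => []
  | _ + 1, [] => []
  | fuel + 1, it :: rest =>
      match ((it :: rest).getLastD []).head? with
      | none => []
      | some mx =>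
          match it with
          | [] => []
          | v :: vs =>
              if v = mx then v :: lfSearch fuel (rest ++ [vs])
              else lfSearch fuel (rest ++ [(v :: vs).dropWhile (fun w => decide (w < mx))])

/-- Leapfrog join: the intersection of unary relations that are given as increasing lists.  Every
round of the search discards a value of some list, which bounds the number of rounds. -/
def leapfrog (its : List (List ℕ)) : List ℕ :=
  if its.any List.isEmpty then []
  else lfSearch ((its.map List.length).sum + 1)
    (its.insertionSort (fun u v => u.headD 0 ≤ v.headD 0))

/-- A trie iterator below the current node: the variables still to be bound, and the tuples below
the node in lexicographic order. -/
structure Trie where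
  vars : List ℕ
  tuples : List (List ℕ)

/-- The values at the children of the current node. -/
def Trie.keys (T : Trie) : List ℕ := (T.tuples.map (fun t => t.headD 0)).dedup

/-- Move down to the child with value `v`. -/
def Trie.openAt (T : Trie) (v : ℕ) : Trie :=
  ⟨T.vars.tail, (T.tuples.filter (fun t => decide (t.head? = some v))).map List.tail⟩

/-- Leapfrog Triejoin: bind the `d` variables `x, x + 1, …, x + d - 1` in this order. -/
def lftj : (d x : ℕ) → List Trie → List (List ℕ)
  | 0, _, _ => [[]]
  | d + 1, x, Ts =>
      (leapfrog ((Ts.filter (fun T => decide (T.vars.head? = some x))).map Trie.keys)).flatMap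
        fun v => (lftj d (x + 1)
          (Ts.map (fun T => if T.vars.head? = some x then T.openAt v else T))).map (fun t => v :: t)

/-! ## The boxing procedure -/

section Boxing

variable (Q : Query)

/-- An atom that still has to be provisioned, with the values of its first variables for which it
has been spilled (none if it has not been spilled yet). -/
structure Pending where
  atom : Fin Q.m
  pre : List ℕ

/-- The number of the next variable of a pending atom. -/
def Pending.nextVar {Q : Query} (A : Pending Q) : Option ℕ :=
  (Q.atomVars A.atom)[A.pre.length]?

/-- The atoms whose first variable is `x_i`. -/
def preds (i : ℕ) : List (Pending Q) :=
  ((List.finRange Q.m).filter (fun j => decide ((Q.atomVars j).head? = some i))).map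
    (fun j => ⟨j, []⟩)

/-- Data of an execution: block size, available memory in blocks, bound on the number of rounds of
each loop, and the lengths of the first value arrays. -/
structure Params where
  B : ℕ
  memMax : ℕ
  fuel : ℕ
  N : Fin Q.r → ℕ

variable {Q} (P : Params Q)

/-- Probe one atom from the lower bound `low`. -/
def probeAtom (low mem : ℕ) (A : Pending Q) : Prog (File Q.r) (Pending Q × Option (WithTop ℕ)) := do
  let s := Q.rel A.atom
  let h ← probe P.B s (Q.arity s) (P.N s) A.pre low mem
  return (A, h)

/-- Provision one atom from `low` to `high`. -/
def provisionAtom (low : ℕ) (high : WithTop ℕ) (A : Pending Q) : Prog (File Q.r) (Trie × ℕ) := do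
  let s := Q.rel A.atom
  let (ts, used) ← provision P.B s (Q.arity s) (P.N s) A.pre low high
  return (⟨Q.atomVars A.atom, ts⟩, used)

/-- The boxing procedure at dimension `i`, when `d` dimensions (`i` included) remain.  `leftover` is
the memory in blocks left over by the previous dimensions, `spills` lists the spilled atoms that are
not yet provisioned, `slices` the slices provisioned so far, `buf` is the output buffer; the new
output buffer is returned.  With no dimension left, Leapfrog Triejoin is run on the slices.

In each round of the loop at dimension `i`, the atoms that have `x_i` as first variable, and the
spilled atoms that have it as next variable, are probed with an even share of the memory of this
dimension.  If none of them spills, the upper bound is the least of the bounds obtained, and it is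
`low` if there is a spill; a spilled atom is passed on to the dimension of its next variable. -/
def boxUp : (d i leftover : ℕ) → (spills : List (Pending Q)) → (slices : List Trie) →
    (buf : List ℕ) → Prog (File Q.r) (List ℕ)
  | 0, _, _, spills, slices, buf =>
      if spills.isEmpty then Prog.appendOut P.B buf (lftj Q.n 0 slices).flatten else Prog.fail
  | d + 1, i, leftover, spills, slices, buf =>
      let mem := P.memMax / Q.n + leftover
      let atms := preds Q i ++ spills.filter (fun A => decide (A.nextVar = some i))
      let waiting := spills.filter (fun A => decide (A.nextVar ≠ some i))
      Prog.repeatUntil (fun st : ℕ × List ℕ => do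
        let (low, buf) := st
        let probes ← Prog.seq (atms.map (probeAtom P low (mem / atms.length)))
        let high : WithTop ℕ := (probes.map (fun Ah => Ah.2.getD (low : WithTop ℕ))).foldr min ⊤
        let spilled := (probes.filter (fun Ah => Ah.2.isNone)).map
          (fun Ah => (⟨Ah.1.atom, Ah.1.pre ++ [low]⟩ : Pending Q))
        let fitting := (probes.filter (fun Ah => Ah.2.isSome)).map Prod.fst
        let provisioned ← Prog.seq (fitting.map (provisionAtom P low high))
        let usedMem := (provisioned.map Prod.snd).sum
        let buf ← boxUp d (i + 1) (mem - usedMem) (waiting ++ spilled)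
          (slices ++ provisioned.map Prod.fst) buf
        if high = ⊤ then return Sum.inr buf
        else return Sum.inl (high.untopD 0 + 1, buf)) P.fuel (0, buf)

/-- Boxed Leapfrog Triejoin. -/
def main : Prog (File Q.r) Unit := do
  let buf ← boxUp P Q.n 0 0 [] [] []
  Prog.flushOut buf

end Boxing

/-- The boxed Leapfrog Triejoin for the query `Q` with `M` words of memory and block size `B`, on an
input `I` stored as TrieArrays.  One block of memory is set aside for the output buffer. -/
def program (Q : Query) (M B fuel : ℕ) (I : Q.Input) : Prog (File Q.r) Unit :=
  main (Q := Q) ⟨B, M / B - 1, fuel, fun s => (valArray (Q.tuples I s) 0).length⟩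

/-- The execution halts after exactly `c` block transfers.  (Loops are unbounded: the number of
rounds that is allowed for each loop does not matter once it is large enough.) -/
def HaltsWithCost (Q : Query) (M B : ℕ) (I : Q.Input) (c : ℕ) : Prop :=
  ∀ᶠ fuel in atTop, (program Q M B fuel I).cost B (Q.disk I) = some c

end BoxedLFTJ

/-! The bound rests on showing that every loop runs for a number of rounds that depends only on `Q`
and `c`. Each active atom is allotted at least `(M / B - 1) / n / m` blocks, a constant fraction of
`M` words, hence of `|I|` because `|I| ≤ c M`. A round that is not the last of its loop has a finite
upper bound `h`, and this bound comes from an atom that spilled or whose slice up to `h + 1` did not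
fit. The slice of that atom from `low` to `h + 1` therefore contains more than `|I| / D` tuples, for
a constant `D` (`exists_heavy`, `inputSize_lt_mul`).

The ranges `[low, h + 1]` of successive rounds overlap in one value, so a potential counts every
tuple at most twice for each atom. It starts at no more than `2 m D |I|` and loses at least `|I|` in
every round but the last (`potential_add_le`). So there are at most `r = 2 m D + 1` rounds per loop,
and nesting over `n` dimensions keeps the total constant. One round probes and provisions at most
`m` atoms, at a cost of `O(log |I| + |I| / B)` with constants from `Q` (`halts_probe`,
`halts_provision`). The hypothesis on `ln |I|` turns this into `O(|I| / B)`.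

For the writes it suffices that Leapfrog Triejoin is sound and free of repetitions (`lftj_sound`);
its completeness plays no role in an upper bound. Each round owns a box of output tuples, and the
boxes of different rounds of one loop are disjoint since their components at the current dimension
lie in disjoint intervals. So at most `n K` words are written in all, and buffering makes this `n K
/ B` blocks plus one.

`halts_boxUp` joins the two accounts in an induction over the dimensions. -/

namespace BoxedLFTJ

/-! ### Cost semantics of external-memory programs and rules for sequencing them. -/

namespace Prog

variable {F α β : Type} (B : ℕ) (disk : F → List ℕ)

/-- The value returned by a run, together with the number of its block transfers. -/
def run : Prog F α → Option (α × ℕ)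
  | pure a => some (a, 0)
  | fail => none
  | read f k next => (run (next (((disk f).drop (k * B)).take B))).map (fun x => (x.1, x.2 + 1))
  | write blk next => if blk.length ≤ B then (run next).map (fun x => (x.1, x.2 + 1)) else none

theorem cost_eq_run (p : Prog F α) : p.cost B disk = (p.run B disk).map Prod.snd := by
  induction p with
  | pure a => rfl
  | fail => rfl
  | read f k next ih => simp [cost, run, ih, Function.comp_def]
  | write blk next ih =>
    simp only [cost, run, ih]
    split <;> simp [Function.comp_def]

variable {B disk}

theorem run_pure (a : α) : (Pure.pure a : Prog F α).run B disk = some (a, 0) := rfl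

theorem run_bind {p : Prog F α} {g : α → Prog F β} {a : α} {b : β} {c c' : ℕ}
    (hp : p.run B disk = some (a, c)) (hg : (g a).run B disk = some (b, c')) :
    (p >>= g).run B disk = some (b, c + c') := by
  change (p.bind g).run B disk = _
  induction p generalizing c with
  | pure x =>
    simp only [run, Option.some.injEq, Prod.mk.injEq] at hp
    obtain ⟨rfl, rfl⟩ := hp
    simpa [Prog.bind] using hg
  | fail => simp [run] at hp
  | read f k next ih =>
    simp only [run, Option.map_eq_some_iff] at hp
    obtain ⟨⟨x, y⟩, h1, h2⟩ := hp
    simp only [Prod.mk.injEq] at h2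
    obtain ⟨rfl, rfl⟩ := h2
    simp only [Prog.bind, run, ih _ h1, Option.map_some]
    congr 2; omega
  | write blk next ih =>
    simp only [run] at hp
    split at hp
    · rename_i hB
      simp only [Option.map_eq_some_iff] at hp
      obtain ⟨⟨x, y⟩, h1, h2⟩ := hp
      simp only [Prod.mk.injEq] at h2
      obtain ⟨rfl, rfl⟩ := h2
      simp only [Prog.bind, run, if_pos hB, ih h1, Option.map_some]
      congr 2; omega
    · simp at hp

variable (B disk) in
/-- The run halts with a value and a cost that satisfy `Φ`. -/
def Halts (p : Prog F α) (Φ : α → ℕ → Prop) : Prop :=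
  ∃ a c, p.run B disk = some (a, c) ∧ Φ a c

theorem Halts.mono {p : Prog F α} {Φ Ψ : α → ℕ → Prop} (h : p.Halts B disk Φ)
    (hΦ : ∀ a c, Φ a c → Ψ a c) : p.Halts B disk Ψ :=
  let ⟨a, c, h1, h2⟩ := h
  ⟨a, c, h1, hΦ a c h2⟩

theorem Halts.pure {a : α} {Φ : α → ℕ → Prop} (h : Φ a 0) :
    (Pure.pure a : Prog F α).Halts B disk Φ :=
  ⟨a, 0, rfl, h⟩

/-- The sequencing rule of a Hoare logic with costs: the cost already spent is carried into the
postcondition of the continuation. -/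
theorem Halts.bind {p : Prog F α} {g : α → Prog F β} {Φ : α → ℕ → Prop} {Ψ : β → ℕ → Prop}
    (hp : p.Halts B disk Φ)
    (hg : ∀ a c, Φ a c → (g a).Halts B disk (fun b c' => Ψ b (c + c'))) :
    (p >>= g).Halts B disk Ψ := by
  obtain ⟨a, c, h1, h2⟩ := hp
  obtain ⟨b, c', h3, h4⟩ := hg a c h2
  exact ⟨b, c + c', run_bind h1 h3, h4⟩

theorem halts_seq {γ : Type} {f : γ → Prog F α} {Φ : γ → α → Prop} {X : ℕ} (l : List γ)
    (h : ∀ x ∈ l, (f x).Halts B disk (fun a c => Φ x a ∧ c ≤ X)) :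
    (seq (l.map f)).Halts B disk (fun as c => List.Forall₂ Φ l as ∧ c ≤ l.length * X) := by
  induction l with
  | nil => exact Halts.pure ⟨.nil, by simp⟩
  | cons x l ih =>
    refine (h x (by simp)).bind fun a c ⟨h1, h2⟩ => ?_
    refine (ih fun y hy => h y (by simp [hy])).bind fun as c' ⟨h3, h4⟩ => ?_
    refine Halts.pure ⟨.cons h1 h3, ?_⟩
    simp only [List.length_cons, Nat.add_mul]
    omega

theorem run_readWord (hB : 1 ≤ B) (f : F) (i : ℕ) :
    (readWord B f i).run B disk = some ((disk f).getD i 0, 1) := by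
  simp only [readWord, run, Option.map_some, Option.some.injEq, Prod.mk.injEq, zero_add, and_true]
  rw [List.getD_eq_getElem?_getD, List.getElem?_take_of_lt (Nat.mod_lt _ hB), List.getElem?_drop,
    Nat.div_add_mod', List.getD_eq_getElem?_getD]

theorem halts_readWord (hB : 1 ≤ B) (f : F) (i : ℕ) :
    (readWord B f i).Halts B disk (fun w c => w = (disk f).getD i 0 ∧ c = 1) :=
  ⟨_, _, run_readWord hB f i, rfl, rfl⟩

theorem flatten_blocks (l : List ℕ) (k n : ℕ) :
    ((List.range' k n).map (fun k => (l.drop (k * B)).take B)).flatten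
      = (l.drop (k * B)).take (n * B) := by
  induction n generalizing k with
  | zero => simp
  | succ n ih =>
    rw [List.range'_succ, List.map_cons, List.flatten_cons, ih, Nat.succ_mul, Nat.succ_mul,
      Nat.add_comm (n * B), List.take_add, List.drop_drop]

theorem run_seq_read (f : F) (l : List ℕ) :
    (seq (l.map (fun k => read f k (fun w => pure w)))).run B disk
      = some (l.map (fun k => ((disk f).drop (k * B)).take B), l.length) := by
  induction l with
  | nil => rfl
  | cons x l ih =>
    refine (run_bind (p := read f x fun w => pure w) (a := ((disk f).drop (x * B)).take B) (c := 1)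
      rfl (run_bind ih (run_pure (_ :: _)))).trans ?_
    simp [Nat.add_comm]

theorem halts_readRange (hB : 1 ≤ B) (f : F) (lo hi : ℕ) :
    (readRange B f lo hi).Halts B disk
      (fun ws c => ws = ((disk f).drop lo).take (hi - lo) ∧ c ≤ (hi - lo) / B + 2) := by
  unfold readRange
  split
  · rename_i h
    refine ⟨_, _, run_bind (run_seq_read f _) (run_pure _), ?_, ?_⟩
    · rw [flatten_blocks]
      rw [List.drop_take, List.drop_drop, Nat.div_add_mod', List.take_take]
      congr 1
      -- The last block read contains position `hi - 1`, so the blocks reach far enough for the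
      -- final `take` not to be cut short.
      apply min_eq_left
      have h1 := Nat.div_add_mod' (hi - 1) B
      have h2 := Nat.mod_lt (hi - 1) hB
      have h3 := Nat.div_add_mod' lo B
      have h4 : lo / B ≤ (hi - 1) / B := Nat.div_le_div_right (by omega)
      obtain ⟨e, he⟩ := Nat.exists_eq_add_of_le h4
      rw [he, Nat.add_mul] at h1
      rw [he, Nat.add_sub_cancel_left, Nat.add_mul]
      omega
    · simp only [List.length_range', add_zero]
      obtain ⟨e, rfl⟩ := Nat.exists_eq_add_of_lt h
      -- Misalignment at the start of the range can add one block; the other extra block is the one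
      -- counted by `+ 1` in the number of blocks.
      have h2 : (lo + e) / B ≤ lo / B + e / B + 1 := by
        rw [Nat.add_div (by omega)]
        split <;> omega
      have h3 : e / B ≤ (lo + e + 1 - lo) / B := Nat.div_le_div_right (by omega)
      have h4 : lo + e + 1 - 1 = lo + e := rfl
      rw [h4]
      generalize (lo + e) / B = x at *
      generalize (lo + e + 1 - lo) / B = y at *
      generalize lo / B = z at *
      generalize e / B = w at *
      omega
  · rename_i h
    refine Halts.pure ⟨?_, Nat.zero_le _⟩
    rw [Nat.sub_eq_zero_of_le (by omega)]; simp

/-- The result of a binary search for a test of cost at most `t`.  No monotonicity of the test is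
needed for the stated property. -/
theorem halts_bsearch {P : ℕ → Prog F Bool} {p : ℕ → Prop} {t lo₀ hi₀ : ℕ}
    (hP : ∀ q, lo₀ ≤ q → q < hi₀ → (P q).Halts B disk (fun b c => (b = true ↔ p q) ∧ c ≤ t))
    (L lo hi : ℕ) (h₀ : lo₀ ≤ lo) (h₁ : hi ≤ hi₀) (hle : lo ≤ hi) (hL : hi - lo < 2 ^ L) :
    (bsearch P lo hi).Halts B disk (fun q c => lo ≤ q ∧ q ≤ hi ∧ (q < hi → p q) ∧
      (lo < q → ¬ p (q - 1)) ∧ c ≤ L * t) := by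
  induction L generalizing lo hi with
  | zero =>
    unfold bsearch
    rw [if_neg (by simp at hL; omega)]
    exact Halts.pure ⟨le_rfl, hle, fun h => absurd h (by simp at hL; omega), by omega, by omega⟩
  | succ L ih =>
    unfold bsearch
    split
    · rename_i hlt
      rw [pow_succ] at hL
      refine (hP ((lo + hi) / 2) (by omega) (by omega)).bind fun b c ⟨hb, hc⟩ => ?_
      cases b with
      | true =>
        refine (ih lo ((lo + hi) / 2) h₀ (by omega) (by omega) (by omega)).mono ?_
        rintro q c' ⟨h2, h3, h4, h5, h6⟩
        refine ⟨h2, by omega, fun _ => ?_, h5, by rw [Nat.succ_mul]; omega⟩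
        rcases h3.lt_or_eq with h | h
        · exact h4 h
        · rw [h]; exact hb.1 rfl
      | false =>
        refine (ih ((lo + hi) / 2 + 1) hi (by omega) h₁ (by omega) (by omega)).mono ?_
        rintro q c' ⟨h2, h3, h4, h5, h6⟩
        refine ⟨by omega, h3, h4, fun _ => ?_, by rw [Nat.succ_mul]; omega⟩
        rcases h2.lt_or_eq with h | h
        · exact h5 h
        · rw [← h, Nat.add_sub_cancel]; exact fun hp => by simpa using hb.2 hp
    · rename_i hlt
      exact Halts.pure ⟨le_rfl, hle, fun h => absurd h hlt, by omega, by omega⟩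

/-- The balance is an equality because a block is written only when it is full. Words left in the
buffer act as credit, so rounding up is paid once at the final flush and not in every round. -/
theorem halts_appendOut (hB : 1 ≤ B) (ws : List ℕ) (buf : List ℕ) (hbuf : buf.length < B) :
    (appendOut B buf ws : Prog F (List ℕ)).Halts B disk (fun buf' c =>
      buf'.length < B ∧ B * c + buf'.length = buf.length + ws.length) := by
  induction ws generalizing buf with
  | nil => exact Halts.pure ⟨hbuf, by simp⟩
  | cons w ws ih =>
    unfold appendOut
    split
    · obtain ⟨a, c, h1, h2, h3⟩ := ih [] hB
      refine ⟨a, c + 1, ?_, h2, ?_⟩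
      · rw [run, if_pos (by simp; omega), h1]; rfl
      · simp only [List.length_nil, List.length_cons] at h3 ⊢
        rw [Nat.mul_succ]; omega
    · refine (ih (buf ++ [w]) (by simp; omega)).mono fun a c h => ⟨h.1, ?_⟩
      rw [h.2]; simp; omega

theorem halts_flushOut (buf : List ℕ) (hbuf : buf.length ≤ B) :
    (flushOut buf : Prog F Unit).Halts B disk (fun _ c => c ≤ 1) := by
  unfold flushOut
  split
  · exact Halts.pure (by omega)
  · exact ⟨(), 1, by rw [run, if_pos hbuf]; rfl, le_rfl⟩

end Prog

/-! ## The arrays of a trie -/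

theorem lex_cons_le_cons {a b : ℕ} {l l' : List ℕ} : a :: l ≤ b :: l' ↔ a < b ∨ a = b ∧ l ≤ l' := by
  have h : ∀ u v : List ℕ, u ≤ v ↔ ¬ v < u := fun u v => not_lt.symm
  rw [h, h, List.cons_lt_cons_iff]
  constructor
  · intro h1
    by_cases h2 : a < b
    · exact Or.inl h2
    · have h3 : a = b := by
        by_contra h4
        exact h1 (Or.inl (by omega))
      exact Or.inr ⟨h3, fun h4 => h1 (Or.inr ⟨h3.symm, h4⟩)⟩
  · rintro (h1 | ⟨h1, h2⟩) (h3 | ⟨h3, h4⟩)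
    · omega
    · omega
    · omega
    · exact h2 h4

theorem lex_nil_le (l : List ℕ) : [] ≤ l := by
  rw [← not_lt]
  exact List.not_lt_nil l

theorem lex_take_le_take (n : ℕ) {l l' : List ℕ} (h : l ≤ l') : l.take n ≤ l'.take n := by
  induction n generalizing l l' with
  | zero => simp
  | succ n ih =>
    cases l with
    | nil => simpa using lex_nil_le _
    | cons a l =>
      cases l' with
      | nil => exact absurd (List.nil_lt_cons a l) (not_lt.2 h)
      | cons b l' =>
        rw [List.take_succ_cons, List.take_succ_cons, lex_cons_le_cons]
        rcases lex_cons_le_cons.1 h with h | ⟨h, h'⟩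
        · exact Or.inl h
        · exact Or.inr ⟨h, ih h'⟩

theorem lex_append_le_append_iff (u : List ℕ) {l l' : List ℕ} : u ++ l ≤ u ++ l' ↔ l ≤ l' := by
  induction u with
  | nil => rfl
  | cons a u ih => simp [lex_cons_le_cons, ih]

/-- A test that is closed towards the front of a list selects an initial segment, so the number of
selected elements is a threshold for positions. This is how counts in an index array become position
ranges. -/
theorem lt_length_filter_iff {α : Type*} {r : α → α → Prop} {P : α → Bool} (l : List α)
    (hl : l.Pairwise r) (hP : ∀ u v, u ∈ l → v ∈ l → r u v → P v = true → P u = true) (x : ℕ)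
    (hx : x < l.length) : x < (l.filter P).length ↔ P l[x] = true := by
  induction l generalizing x with
  | nil => simp at hx
  | cons u l ih =>
    rw [List.pairwise_cons] at hl
    have ih' := ih hl.2 fun u v hu hv => hP u v (by simp [hu]) (by simp [hv])
    by_cases hu : P u = true
    · rw [List.filter_cons_of_pos hu]
      cases x with
      | zero => simpa using hu
      | succ x => simpa using ih' x (by simpa using hx)
    · have hno : ∀ v ∈ l, ¬ P v = true := fun v hv h =>
        hu (hP u v (by simp) (by simp [hv]) (hl.1 v hv) h)
      rw [List.filter_cons_of_neg hu, List.filter_eq_nil_iff.2 hno]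
      cases x with
      | zero => simpa using hu
      | succ x => simpa using hno _ (List.getElem_mem _)

section Arrays

variable (R : Finset (List ℕ))

/-- The number of nodes at level `k`. -/
def width (k : ℕ) : ℕ := (trieNodes R k).length

/-- The node at position `x` of level `k`. -/
def node (k x : ℕ) : List ℕ := (trieNodes R k).getD x []

/-- The word at position `x` of the value array of level `k`. -/
def valAt (k x : ℕ) : ℕ := (valArray R k).getD x 0

/-- The word at position `j` of the index array of level `k`. -/
def idxAt (k j : ℕ) : ℕ := (idxArray R k).getD j 0

variable {R}

theorem mem_trieNodes {k : ℕ} {p : List ℕ} : p ∈ trieNodes R k ↔ ∃ t ∈ R, t.take (k + 1) = p := by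
  simp [trieNodes, Finset.mem_sort]

theorem width_le_card (k : ℕ) : width R k ≤ R.card := by
  rw [width, trieNodes, Finset.length_sort]
  exact Finset.card_image_le

theorem length_valArray (k : ℕ) : (valArray R k).length = width R k := by
  simp [valArray, width]

theorem length_idxArray (k : ℕ) : (idxArray R k).length = width R k + 1 := by
  simp [idxArray, width]

theorem node_eq_getElem {k x : ℕ} (hx : x < width R k) :
    node R k x = (trieNodes R k)[x]'hx :=
  List.getD_eq_getElem _ _ hx

theorem node_mem {k x : ℕ} (hx : x < width R k) : node R k x ∈ trieNodes R k := by
  rw [node_eq_getElem hx]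
  exact List.getElem_mem _

theorem node_lt_node {k x y : ℕ} (hxy : x < y) (hy : y < width R k) :
    node R k x < node R k y := by
  rw [node_eq_getElem hy, node_eq_getElem (hxy.trans hy)]
  exact (Finset.sortedLT_sort _).pairwise.rel_get_of_lt (a := ⟨x, hxy.trans hy⟩) (b := ⟨y, hy⟩) hxy

theorem node_injOn {k x y : ℕ} (hx : x < width R k) (hy : y < width R k)
    (h : node R k x = node R k y) : x = y := by
  rcases lt_trichotomy x y with hlt | heq | hlt
  · exact absurd h (node_lt_node hlt hy).ne
  · exact heq
  · exact absurd h (node_lt_node hlt hx).ne'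

theorem valAt_eq {k x : ℕ} (hx : x < width R k) : valAt R k x = (node R k x).getD k 0 := by
  have hx' : x < (valArray R k).length := by rwa [length_valArray]
  rw [valAt, List.getD_eq_getElem _ _ hx', node_eq_getElem hx]
  simp only [valArray, List.getElem_map]
  rfl

theorem idxAt_eq {k j : ℕ} (hj : j ≤ width R k) : idxAt R k j =
    ((trieNodes R (k + 1)).filter
      (fun q => decide (q.take (k + 1) ∈ (trieNodes R k).take j))).length := by
  have hj' : j < (idxArray R k).length := by rw [length_idxArray]; omega
  rw [idxAt, List.getD_eq_getElem _ _ hj']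
  simp [idxArray]

theorem idxAt_le_width {k j : ℕ} (hj : j ≤ width R k) : idxAt R k j ≤ width R (k + 1) := by
  rw [idxAt_eq hj]
  exact List.length_filter_le _ _

theorem idxAt_mono {k j j' : ℕ} (hjj : j ≤ j') (hj : j' ≤ width R k) :
    idxAt R k j ≤ idxAt R k j' := by
  rw [idxAt_eq hj, idxAt_eq (hjj.trans hj), ← List.countP_eq_length_filter,
    ← List.countP_eq_length_filter]
  refine List.countP_mono_left fun q _ hq => ?_
  simp only [decide_eq_true_eq] at hq ⊢
  exact List.take_subset_take_left _ hjj hq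

theorem mem_take_trieNodes {k j : ℕ} {p : List ℕ} :
    p ∈ (trieNodes R k).take j ↔ ∃ x, x < j ∧ x < width R k ∧ node R k x = p := by
  rw [List.mem_take_iff_getElem]
  constructor
  · rintro ⟨x, hx, rfl⟩
    have hx' : x < width R k := by rw [width]; omega
    exact ⟨x, by omega, hx', node_eq_getElem hx'⟩
  · rintro ⟨x, hx, hx', rfl⟩
    exact ⟨x, by rw [width] at hx'; omega, (node_eq_getElem hx').symm⟩

/-- Truncation is monotone for the lexicographic order. Hence the nodes whose parent is among the
first `j` nodes come first at their level, and the index word is the position where they end. -/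
theorem lt_idxAt_iff {k j x : ℕ} (hj : j ≤ width R k) (hx : x < width R (k + 1)) :
    x < idxAt R k j ↔ ∃ y, y < j ∧ y < width R k ∧ node R k y = (node R (k + 1) x).take (k + 1) := by
  rw [idxAt_eq hj, lt_length_filter_iff (trieNodes R (k + 1))
    (Finset.sortedLT_sort _).pairwise _ x hx, node_eq_getElem hx, decide_eq_true_eq,
    mem_take_trieNodes]
  intro u v hu hv huv hPv
  simp only [decide_eq_true_eq] at hPv ⊢
  obtain ⟨y, hy, hyw, hyv⟩ := mem_take_trieNodes.1 hPv
  obtain ⟨t, ht, rfl⟩ := mem_trieNodes.1 hu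
  have hm : (t.take (k + 1 + 1)).take (k + 1) ∈ trieNodes R k :=
    mem_trieNodes.2 ⟨t, ht, by rw [List.take_take]; simp⟩
  rw [← List.take_length (l := trieNodes R k)] at hm
  obtain ⟨z, hz, hzw, hzv⟩ := mem_take_trieNodes.1 hm
  refine mem_take_trieNodes.2 ⟨z, ?_, hzw, hzv⟩
  by_contra hjz
  -- If the parent of the smaller child came at position `j` or later, it would lie strictly after
  -- the parent of the larger child, against monotonicity of truncation.
  have h1 := node_lt_node (R := R) (k := k) (x := y) (y := z) (by omega) hzw
  rw [hzv, hyv] at h1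
  exact absurd (lex_take_le_take (k + 1) huv.le) (not_le.2 h1)

/-- The children of the node at position `j` occupy the positions given by the index array. -/
theorem parent_eq {k j x : ℕ} (hj : j < width R k) (h1 : idxAt R k j ≤ x)
    (h2 : x < idxAt R k (j + 1)) : (node R (k + 1) x).take (k + 1) = node R k j := by
  have hx : x < width R (k + 1) := h2.trans_le (idxAt_le_width hj)
  obtain ⟨y, hy, hyw, hyv⟩ := (lt_idxAt_iff (by omega) hx).1 h2
  have h3 : ¬ y < j := fun h =>
    absurd ((lt_idxAt_iff (R := R) (j := j) hj.le hx).2 ⟨y, h, hyw, hyv⟩) (by omega)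
  rw [← hyv, show y = j by omega]

theorem exists_parent {k p q x : ℕ} (hp : p ≤ q) (hq : q ≤ width R k) (h1 : idxAt R k p ≤ x)
    (h2 : x < idxAt R k q) :
    ∃ y, p ≤ y ∧ y < q ∧ (node R (k + 1) x).take (k + 1) = node R k y := by
  have hx : x < width R (k + 1) := h2.trans_le (idxAt_le_width hq)
  obtain ⟨y, hy, hyw, hyv⟩ := (lt_idxAt_iff hq hx).1 h2
  refine ⟨y, ?_, hy, hyv.symm⟩
  by_contra h
  exact absurd ((lt_idxAt_iff (R := R) (j := p) (hp.trans hq) hx).2 ⟨y, by omega, hyw, hyv⟩)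
    (by omega)

theorem length_node {a : ℕ} (hR : ∀ t ∈ R, t.length = a) {k x : ℕ} (hk : k < a)
    (hx : x < width R k) : (node R k x).length = k + 1 := by
  obtain ⟨t, ht, h⟩ := mem_trieNodes.1 (node_mem hx)
  rw [← h, List.length_take, hR t ht]
  omega

theorem node_eq_append {a : ℕ} (hR : ∀ t ∈ R, t.length = a) {k x : ℕ} (hk : k < a)
    (hx : x < width R k) : node R k x = (node R k x).take k ++ [valAt R k x] := by
  have h := length_node hR hk hx
  have h2 : k < (node R k x).length := by omega
  rw [valAt_eq hx, List.getD_eq_getElem _ _ h2, List.take_append_getElem]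
  rw [List.take_of_length_le (by omega)]

/-- The positions `lo, …, hi - 1` of level `k` hold nodes with the common prefix `pre`. -/
def Siblings (R : Finset (List ℕ)) (k : ℕ) (pre : List ℕ) (lo hi : ℕ) : Prop :=
  lo ≤ hi ∧ hi ≤ width R k ∧ ∀ x, lo ≤ x → x < hi → (node R k x).take k = pre

theorem Siblings.sub {k : ℕ} {pre : List ℕ} {lo hi p q : ℕ} (h : Siblings R k pre lo hi)
    (h1 : lo ≤ p) (h2 : p ≤ q) (h3 : q ≤ hi) : Siblings R k pre p q :=
  ⟨h2, h3.trans h.2.1, fun x hx hx' => h.2.2 x (h1.trans hx) (hx'.trans_le h3)⟩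

theorem Siblings.node_eq {a : ℕ} (hR : ∀ t ∈ R, t.length = a) {k : ℕ} (hk : k < a) {pre : List ℕ}
    {lo hi x : ℕ} (h : Siblings R k pre lo hi) (h1 : lo ≤ x) (h2 : x < hi) :
    node R k x = pre ++ [valAt R k x] := by
  rw [node_eq_append hR hk (h2.trans_le h.2.1), h.2.2 x h1 h2]

theorem Siblings.valAt_lt {a : ℕ} (hR : ∀ t ∈ R, t.length = a) {k : ℕ} (hk : k < a) {pre : List ℕ}
    {lo hi x y : ℕ} (h : Siblings R k pre lo hi) (h1 : lo ≤ x) (h2 : x < y) (h3 : y < hi) :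
    valAt R k x < valAt R k y := by
  have h4 := node_lt_node h2 (h3.trans_le h.2.1)
  rw [h.node_eq hR hk h1 (h2.trans h3), h.node_eq hR hk (h1.trans h2.le) h3, ← not_le,
    lex_append_le_append_iff, lex_cons_le_cons] at h4
  simp only [le_refl, and_true, not_or] at h4
  omega

theorem Siblings.valAt_le {a : ℕ} (hR : ∀ t ∈ R, t.length = a) {k : ℕ} (hk : k < a) {pre : List ℕ}
    {lo hi x y : ℕ} (h : Siblings R k pre lo hi) (h1 : lo ≤ x) (h2 : x ≤ y) (h3 : y < hi) :
    valAt R k x ≤ valAt R k y := by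
  rcases h2.eq_or_lt with rfl | h2
  · exact le_rfl
  · exact (h.valAt_lt hR hk h1 h2 h3).le

theorem siblings_top : Siblings R 0 [] 0 (width R 0) :=
  ⟨Nat.zero_le _, le_rfl, fun _ _ _ => by simp⟩

theorem siblings_empty (k : ℕ) (pre : List ℕ) : Siblings R k pre 0 0 :=
  ⟨le_rfl, Nat.zero_le _, fun _ _ h => absurd h (by omega)⟩

theorem siblings_children {k j : ℕ} (hj : j < width R k) :
    Siblings R (k + 1) (node R k j) (idxAt R k j) (idxAt R k (j + 1)) :=
  ⟨idxAt_mono (by omega) hj, idxAt_le_width hj, fun _ h1 h2 => parent_eq hj h1 h2⟩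

/-- The tuples below the positions `p, …, q - 1` of level `k`. -/
def below (R : Finset (List ℕ)) (k p q : ℕ) : Finset (List ℕ) :=
  R.filter (fun t => ∃ x ∈ Finset.Ico p q, t.take (k + 1) = node R k x)

/-- Choose one tuple below every node; distinct nodes of a level have distinct prefixes, so the
choice is injective. -/
theorem sub_le_card_below {k p q : ℕ} (hq : q ≤ width R k) : q - p ≤ (below R k p q).card := by
  have h : ∀ x, x ∈ Finset.Ico p q → ∃ t ∈ R, t.take (k + 1) = node R k x := fun x hx =>
    mem_trieNodes.1 (node_mem ((Finset.mem_Ico.1 hx).2.trans_le hq))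
  choose! f hf1 hf2 using h
  rw [← Nat.card_Ico]
  refine Finset.card_le_card_of_injOn f (fun x hx => ?_) (fun x hx y hy hxy => ?_)
  · exact Finset.mem_filter.2 ⟨hf1 x hx, x, hx, hf2 x hx⟩
  · have hx' := (Finset.mem_Ico.1 (Finset.mem_coe.1 hx)).2.trans_le hq
    have hy' := (Finset.mem_Ico.1 (Finset.mem_coe.1 hy)).2.trans_le hq
    refine node_injOn hx' hy' ?_
    rw [← hf2 x hx, ← hf2 y hy, hxy]

theorem below_children_subset {k p q : ℕ} (hp : p ≤ q) (hq : q ≤ width R k) :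
    below R (k + 1) (idxAt R k p) (idxAt R k q) ⊆ below R k p q := by
  intro t ht
  obtain ⟨ht, x, hx, hxt⟩ := Finset.mem_filter.1 ht
  rw [Finset.mem_Ico] at hx
  obtain ⟨y, hy1, hy2, hy3⟩ := exists_parent hp hq hx.1 hx.2
  refine Finset.mem_filter.2 ⟨ht, y, Finset.mem_Ico.2 ⟨hy1, hy2⟩, ?_⟩
  rw [← hy3, ← hxt, List.take_take]
  simp

end Arrays

/-! ## Probing and provisioning -/

/-- The tuples that start with `pre` and whose next component lies in `[l, h]`. -/
def slice (R : Finset (List ℕ)) (pre : List ℕ) (l h : ℕ) : Finset (List ℕ) :=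
  R.filter (fun t => t.take pre.length = pre ∧ l ≤ t.getD pre.length 0 ∧ t.getD pre.length 0 ≤ h)

theorem slice_subset_slice (R : Finset (List ℕ)) (pre : List ℕ) {l h h' : ℕ} (hh : h ≤ h') :
    slice R pre l h ⊆ slice R pre l h' := by
  intro t ht
  simp only [slice, Finset.mem_filter] at ht ⊢
  exact ⟨ht.1, ht.2.1, ht.2.2.1, ht.2.2.2.trans hh⟩

theorem getD_drop_take (l : List ℕ) (lo n i : ℕ) (h : lo ≤ i) (h' : i < lo + n) :
    ((l.drop lo).take n).getD (i - lo) 0 = l.getD i 0 := by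
  rw [List.getD_eq_getElem?_getD, List.getElem?_take_of_lt (by omega), List.getElem?_drop,
    List.getD_eq_getElem?_getD, Nat.add_sub_cancel' h]

theorem take_length_append_singleton (pre : List ℕ) (v : ℕ) (t : List ℕ)
    (h : t.take (pre.length + 1) = pre ++ [v]) :
    t.take pre.length = pre ∧ t.getD pre.length 0 = v := by
  rw [← List.take_append_drop (pre.length + 1) t, h]
  simp

section Specs

variable {r : ℕ} {B : ℕ} {s : Fin r} {a L : ℕ} {disk : File r → List ℕ} {R : Finset (List ℕ)}

theorem Siblings.below_subset_slice (hR : ∀ t ∈ R, t.length = a) {pre : List ℕ}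
    (hk : pre.length < a) {p q l h : ℕ} (hs : Siblings R pre.length pre p q)
    (hl : ∀ x, p ≤ x → x < q → l ≤ valAt R pre.length x)
    (hh : ∀ x, p ≤ x → x < q → valAt R pre.length x ≤ h) :
    below R pre.length p q ⊆ slice R pre l h := by
  intro t ht
  obtain ⟨ht, x, hx, hxt⟩ := Finset.mem_filter.1 ht
  rw [Finset.mem_Ico] at hx
  rw [hs.node_eq hR hk hx.1 hx.2] at hxt
  obtain ⟨h1, h2⟩ := take_length_append_singleton _ _ _ hxt
  exact Finset.mem_filter.2 ⟨ht, h1, h2 ▸ hl x hx.1 hx.2, h2 ▸ hh x hx.1 hx.2⟩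

/-- The inductive step for decoding: `hv` says that the copied values sit at the offset `start`, and
`hc` is the claim for the children of each node. Order across nodes comes from the strictly
increasing values of siblings, order within a node from `hc`. -/
theorem decode_level (hR : ∀ t ∈ R, t.length = a) {k : ℕ} (hk : k < a) (q : ℕ) (L : Level)
    (Ls : List Level)
    (hv : ∀ x, L.start ≤ x → x < q → L.vals.getD (x - L.start) 0 = valAt R k x)
    (hc : ∀ pre x, L.start ≤ x → x < q → node R k x = pre ++ [valAt R k x] →
      (decode Ls (L.idxs.getD (x - L.start) 0) (L.idxs.getD (x + 1 - L.start) 0)).Pairwise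
        (· ≤ ·) ∧
      ∀ t ∈ decode Ls (L.idxs.getD (x - L.start) 0) (L.idxs.getD (x + 1 - L.start) 0),
        pre ++ [valAt R k x] ++ t ∈ R)
    (pre : List ℕ) (lo hi : ℕ) (hlo : L.start ≤ lo) (hhi : hi ≤ q) (hs : Siblings R k pre lo hi) :
    (decode (L :: Ls) lo hi).Pairwise (· ≤ ·) ∧
      ∀ t ∈ decode (L :: Ls) lo hi, pre ++ t ∈ R ∧
        ∃ x, lo ≤ x ∧ x < hi ∧ t.head? = some (valAt R k x) := by
  have hmem : ∀ x ∈ List.range' lo (hi - lo), lo ≤ x ∧ x < hi := by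
    intro x hx
    rw [List.mem_range'_1] at hx
    omega
  have hnode := fun x (hx : lo ≤ x ∧ x < hi) => hs.node_eq hR (by omega) hx.1 hx.2
  unfold decode
  refine ⟨List.pairwise_flatMap.2 ⟨fun x hx => ?_, ?_⟩, fun t ht => ?_⟩
  · have hx := hmem x hx
    refine List.pairwise_map.2 ((hc pre x (by omega) (by omega) (hnode x hx)).1.imp ?_)
    exact fun h => lex_cons_le_cons.2 (Or.inr ⟨rfl, h⟩)
  · refine List.Pairwise.imp_of_mem ?_ (List.pairwise_lt_range' (s := lo) (n := hi - lo))
    intro x y hx hy hxy u hu v hv'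
    have hx := hmem x hx
    have hy := hmem y hy
    obtain ⟨u, -, rfl⟩ := List.mem_map.1 hu
    obtain ⟨v, -, rfl⟩ := List.mem_map.1 hv'
    rw [hv x (by omega) (by omega), hv y (by omega) (by omega)]
    exact lex_cons_le_cons.2 (Or.inl (hs.valAt_lt hR (by omega) hx.1 hxy hy.2))
  · obtain ⟨x, hx, ht⟩ := List.mem_flatMap.1 ht
    have hx := hmem x hx
    obtain ⟨u, hu, rfl⟩ := List.mem_map.1 ht
    rw [hv x (by omega) (by omega)]
    refine ⟨?_, x, hx.1, hx.2, rfl⟩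
    simpa using (hc pre x (by omega) (by omega) (hnode x hx)).2 u hu

variable (hB : 1 ≤ B) (hR : ∀ t ∈ R, t.length = a) (hL : R.card < 2 ^ L)
  (hval : ∀ k, disk (.val s k) = valArray R k) (hidx : ∀ k, disk (.idx s k) = idxArray R k)

include hB hval

theorem halts_readVal (k i : ℕ) : (Prog.readWord B (.val s k) i).Halts B disk
    (fun w c => w = valAt R k i ∧ c = 1) := by
  have h := Prog.halts_readWord hB (disk := disk) (File.val s k) i
  rwa [hval] at h

theorem halts_testVal (k i : ℕ) (P : ℕ → Prop) [DecidablePred P] :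
    (do
      let w ← Prog.readWord B (File.val s k) i
      return decide (P w) : Prog (File r) Bool).Halts B disk
      (fun b c => (b = true ↔ P (valAt R k i)) ∧ c ≤ 1) := by
  refine (halts_readVal hB hval k i).bind ?_
  rintro w c ⟨rfl, rfl⟩
  exact Prog.Halts.pure ⟨by simp, le_rfl⟩

include hL in
theorem halts_bsearchVal (k : ℕ) {pre : List ℕ} {lo hi : ℕ} (hs : Siblings R k pre lo hi)
    (P : ℕ → Prop) [DecidablePred P] :
    (Prog.bsearch (fun q => do
      let w ← Prog.readWord B (File.val s k) q
      return decide (P w)) lo hi).Halts B disk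
      (fun q c => lo ≤ q ∧ q ≤ hi ∧ (q < hi → P (valAt R k q)) ∧
        (lo < q → ¬ P (valAt R k (q - 1))) ∧ c ≤ L) := by
  refine (Prog.halts_bsearch (t := 1) (p := fun q => P (valAt R k q)) (lo₀ := lo) (hi₀ := hi)
    (fun q _ _ => halts_testVal hB hval k q P) L lo hi le_rfl le_rfl hs.1 ?_).mono ?_
  · have h1 := hs.2.1
    have h2 := width_le_card (R := R) k
    omega
  · rintro q c ⟨h1, h2, h3, h4, h5⟩
    exact ⟨h1, h2, h3, h4, by omega⟩

omit hval

include hidx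

theorem halts_readIdx (k i : ℕ) : (Prog.readWord B (.idx s k) i).Halts B disk
    (fun w c => w = idxAt R k i ∧ c = 1) := by
  have h := Prog.halts_readWord hB (disk := disk) (File.idx s k) i
  rwa [hidx] at h

/-- Every level of the slice has at most as many nodes as there are tuples below it, and its index
array is one word longer than its value array. The exact value for `d = 1` serves to exclude spills
at the last level. -/
theorem halts_sliceWords (d k p q : ℕ) (hp : p ≤ q) (hq : q ≤ width R k) :
    (sliceWords B s d k p q).Halts B disk (fun w c =>
      w ≤ d * (2 * (below R k p q).card + 1) ∧ (d = 1 → w = q - p) ∧ c ≤ 2 * d) := by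
  induction d generalizing k p q with
  | zero => exact Prog.Halts.pure ⟨by simp, by simp, by simp⟩
  | succ d ih =>
    have h1 := sub_le_card_below (p := p) hq
    cases d with
    | zero => exact Prog.Halts.pure ⟨by omega, by simp, by omega⟩
    | succ d =>
      unfold sliceWords
      refine (halts_readIdx hB hidx k p).bind ?_
      rintro _ _ ⟨rfl, rfl⟩
      refine (halts_readIdx hB hidx k q).bind ?_
      rintro _ _ ⟨rfl, rfl⟩
      refine (ih (k + 1) _ _ (idxAt_mono hp hq) (idxAt_le_width hq)).bind ?_
      rintro w c ⟨hw, -, hc⟩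
      refine Prog.Halts.pure ⟨?_, by omega, by omega⟩
      have h2 := Finset.card_le_card (below_children_subset hp hq)
      have h3 : (d + 1) * (2 * (below R (k + 1) (idxAt R k p) (idxAt R k q)).card + 1)
          ≤ (d + 1) * (2 * (below R k p q).card + 1) := Nat.mul_le_mul_left _ (by omega)
      have h4 : (d + 1 + 1) * (2 * (below R k p q).card + 1)
          = (d + 1) * (2 * (below R k p q).card + 1) + (2 * (below R k p q).card + 1) := by ring
      omega

include hval hR hL

/-- A level costs one binary search and three single words, whence `L + 3`. When the prefix is
absent the empty range is returned, which satisfies `Siblings` vacuously. -/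
theorem halts_locate (pre pre₀ : List ℕ) (k lo hi : ℕ) (hs : Siblings R k pre₀ lo hi)
    (hk : k + pre.length < a) :
    (locate B s k lo hi pre).Halts B disk (fun x c =>
      Siblings R (k + pre.length) (pre₀ ++ pre) x.1 x.2 ∧ c ≤ pre.length * (L + 3)) := by
  induction pre generalizing pre₀ k lo hi with
  | nil =>
    unfold locate
    exact Prog.Halts.pure ⟨by simpa using hs, by simp⟩
  | cons v pre ih =>
    rw [List.length_cons] at hk
    have hlen : (v :: pre).length * (L + 3) = pre.length * (L + 3) + (L + 3) := by
      rw [List.length_cons]; ring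
    unfold locate
    refine (halts_bsearchVal hB hL hval k hs (fun w => v ≤ w)).bind ?_
    rintro p c ⟨h1, h2, -, -, h5⟩
    split
    · rename_i hp
      refine (halts_readVal hB hval k p).bind ?_
      rintro _ _ ⟨rfl, rfl⟩
      split
      · rename_i hv
        refine (halts_readIdx hB hidx k p).bind ?_
        rintro _ _ ⟨rfl, rfl⟩
        refine (halts_readIdx hB hidx k (p + 1)).bind ?_
        rintro _ _ ⟨rfl, rfl⟩
        have h6 := siblings_children (hp.trans_le hs.2.1)
        rw [hs.node_eq hR (by omega) h1 hp, hv] at h6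
        refine (ih _ (k + 1) _ _ h6 (by omega)).mono ?_
        rintro x c' ⟨h7, h8⟩
        refine ⟨?_, by omega⟩
        rw [List.append_assoc] at h7
        rwa [show k + (v :: pre).length = k + 1 + pre.length by rw [List.length_cons]; omega]
      · exact Prog.Halts.pure ⟨siblings_empty _ _, by omega⟩
    · exact Prog.Halts.pure ⟨siblings_empty _ _, by omega⟩

theorem halts_probe (pre : List ℕ) (l mem : ℕ) (hk : pre.length < a) (hmem : 1 ≤ mem) :
    (probe B s a (width R 0) pre l mem).Halts B disk (fun o c =>
      (o = none → pre.length + 1 < a ∧ mem * B < 3 * a * (slice R pre l l).card) ∧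
      (∀ h, o = some h → (l : WithTop ℕ) ≤ h) ∧
      (∀ h : ℕ, o = some (h : WithTop ℕ) → mem * B < 3 * a * (slice R pre l (h + 1)).card) ∧
      c ≤ a * (3 * L + 3) + L + 1) := by
  -- The two main costs are the descent along `pre` and the search for the end of the slice: at most
  -- `L` size tests, each reading two index words per level.
  have hcost : ∀ c c' : ℕ, c ≤ pre.length * (L + 3) → c' ≤ L * (2 * (a - pre.length)) →
      c + c' ≤ a * (3 * L + 3) := by
    intro c c' h1 h2
    have h3 : pre.length * (L + 3) ≤ a * (L + 3) := Nat.mul_le_mul_right _ hk.le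
    have h4 : L * (2 * (a - pre.length)) ≤ L * (2 * a) := Nat.mul_le_mul_left _ (by omega)
    have h5 : a * (3 * L + 3) = a * (L + 3) + L * (2 * a) := by ring
    omega
  unfold probe
  refine (halts_locate hB hR hL hval hidx pre [] 0 0 (width R 0) siblings_top (by omega)).bind ?_
  rintro ⟨lo, hi⟩ c₁ ⟨hs, hc₁⟩
  simp only [Nat.zero_add, List.nil_append] at hs ⊢
  refine (halts_bsearchVal hB hL hval _ hs (fun w => l ≤ w)).bind ?_
  rintro p c₂ ⟨h1, h2, h3, -, h5⟩
  have hw := fun q (hpq : p ≤ q) (hq : q < hi) => halts_sliceWords (B := B) (s := s) (disk := disk)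
    hB hidx (a - pre.length) pre.length p (q + 1) (by omega) (hq.trans_le hs.2.1)
  -- The tested property is phrased through the run itself: runs are deterministic, so a successful
  -- test can later be matched with the size bound `hw`.
  refine (Prog.halts_bsearch (t := 2 * (a - pre.length)) (p := fun q =>
    ∃ w c, (sliceWords B s (a - pre.length) pre.length p (q + 1)).run B disk = some (w, c) ∧
      mem * B < w) (lo₀ := p) (hi₀ := hi) (fun q h6 h7 => ?_) L p hi le_rfl le_rfl h2 ?_).bind ?_
  · obtain ⟨w, c, hrun, hw1, -, hc⟩ := hw q h6 h7
    refine ⟨decide (mem * B < w), c, ?_, ?_, hc⟩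
    · exact Prog.run_bind (g := fun w => pure (decide (mem * B < w))) hrun (Prog.run_pure _)
    · simp [hrun]
  · have h6 := hs.2.1
    have h7 := width_le_card (R := R) pre.length
    omega
  rintro q c₃ ⟨h6, h7, h8, -, h10⟩
  have hcs := hcost c₁ c₃ hc₁ h10
  split
  swap
  · refine Prog.Halts.pure ⟨by simp, ?_, ?_, by omega⟩
    · rintro h h'
      rw [← Option.some.inj h']; exact le_top
    · rintro h h'
      exact absurd (Option.some.inj h') (WithTop.top_ne_coe)
  rename_i hq
  refine (halts_readVal hB hval _ q).bind ?_
  rintro _ _ ⟨rfl, rfl⟩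
  obtain ⟨w, c, hrun, hmw⟩ := h8 hq
  obtain ⟨w', c', hrun', hw1, hw2, -⟩ := hw q h6 hq
  obtain ⟨rfl, rfl⟩ : w' = w ∧ c' = c := by rw [hrun] at hrun'; simpa [eq_comm] using hrun'
  have hlp : l ≤ valAt R pre.length p := h3 (by omega)
  -- The slice up to position `q` exceeds `mem * B` words and has at least one tuple, so the `+ 1`
  -- in the word count is absorbed by replacing the factor `2` with `3`.
  have heavy : ∀ h, valAt R pre.length q ≤ h → mem * B < 3 * a * (slice R pre l h).card := by
    intro h hh
    have hsub := Siblings.below_subset_slice hR hk (hs.sub h1 (by omega : p ≤ q + 1) hq) (l := l)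
      (h := h) (fun x hx hx' => hlp.trans (hs.valAt_le hR hk h1 hx (by omega)))
      (fun x hx hx' => (hs.valAt_le hR hk (h1.trans hx) (by omega : x ≤ q) hq).trans hh)
    have h11 := Finset.card_le_card hsub
    have h12 := sub_le_card_below (R := R) (k := pre.length) (p := p) (q := q + 1)
      (by have := hs.2.1; omega)
    calc mem * B < w' := hmw
      _ ≤ (a - pre.length) * (2 * (below R pre.length p (q + 1)).card + 1) := hw1
      _ ≤ a * (3 * (slice R pre l h).card) := Nat.mul_le_mul (by omega) (by omega)
      _ = _ := by ring
  split
  · rename_i hv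
    -- Values of siblings increase strictly from a value that is at least `l`, so a value at most
    -- `l` can occur only at the first position.
    have hpq : p = q := by
      by_contra hne
      have := hs.valAt_lt hR hk h1 (by omega : p < q) hq
      omega
    subst hpq
    refine Prog.Halts.pure ⟨fun _ => ⟨?_, heavy l hv⟩, by simp, by simp, by omega⟩
    -- At the last level a slice with one node takes a single word, which fits into any positive
    -- number of blocks. So a spilled atom always has a further variable.
    by_contra hlast
    have := hw2 (by omega)
    have := Nat.mul_le_mul hmem hB
    omega
  · rename_i hv
    refine Prog.Halts.pure ⟨by simp, ?_, ?_, by omega⟩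
    · rintro h h'
      rw [← Option.some.inj h']
      exact Nat.cast_le.2 (by omega)
    · rintro h h'
      have h'' := Nat.cast_injective (Option.some.inj h')
      -- The returned bound is one less than the value at `q`, so the value `h + 1` already makes
      -- the slice too large.
      exact heavy _ (by omega)

omit hL

theorem halts_copyLevels (d k p q : ℕ) (hk : k + (d + 1) = a) (hp : p ≤ q) (hq : q ≤ width R k) :
    (copyLevels B s (d + 1) k p q).Halts B disk (fun Ls c =>
      c ≤ (d + 1) * (2 * ((R.card + 1) / B) + 4) ∧
      ∀ pre lo hi, p ≤ lo → hi ≤ q → Siblings R k pre lo hi →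
        (decode Ls lo hi).Pairwise (· ≤ ·) ∧
        ∀ t ∈ decode Ls lo hi, pre ++ t ∈ R ∧
          ∃ x, lo ≤ x ∧ x < hi ∧ t.head? = some (valAt R k x)) := by
  have hdiv : (q - p) / B ≤ (R.card + 1) / B :=
    Nat.div_le_div_right (by have := width_le_card (R := R) k; omega)
  have hdiv' : (q + 1 - p) / B ≤ (R.card + 1) / B :=
    Nat.div_le_div_right (by have := width_le_card (R := R) k; omega)
  induction d generalizing k p q with
  | zero =>
    unfold copyLevels
    refine (Prog.halts_readRange hB _ p q).bind ?_
    rintro vs c ⟨rfl, hc⟩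
    refine Prog.Halts.pure ⟨by omega, decode_level hR (k := k) (by omega) q ⟨p, _, _⟩ _ ?_ ?_⟩
    · intro x h1 h2
      rw [hval]
      exact getD_drop_take _ _ _ _ h1 (by omega)
    · intro pre x h1 h2 h3
      -- A node of the last level is a whole tuple, so decoding adds just the empty list to it.
      refine ⟨List.pairwise_singleton _ _, fun t ht => ?_⟩
      obtain rfl := List.mem_singleton.1 ht
      obtain ⟨t, ht, htx⟩ := mem_trieNodes.1 (node_mem (R := R) (k := k) (h2.trans_le hq))
      rw [List.append_nil, ← h3, ← htx, List.take_of_length_le (by rw [hR t ht]; omega)]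
      exact ht
  | succ d ih =>
    unfold copyLevels
    refine (Prog.halts_readRange hB _ p q).bind ?_
    rintro vs c ⟨rfl, hc⟩
    refine (Prog.halts_readRange hB _ p (q + 1)).bind ?_
    rintro is c' ⟨rfl, hc'⟩
    have hi : ∀ x, p ≤ x → x < q + 1 →
        (((disk (File.idx s k)).drop p).take (q + 1 - p)).getD (x - p) 0 = idxAt R k x := by
      intro x h1 h2
      rw [hidx]
      exact getD_drop_take _ _ _ _ h1 (by omega)
    have hi0 := hi p le_rfl (by omega)
    rw [Nat.sub_self] at hi0
    rw [hi0, hi q hp (by omega)]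
    have hle := idxAt_le_width hq
    have hw := width_le_card (R := R) (k + 1)
    refine (ih (k + 1) _ _ (by omega) (idxAt_mono hp hq) hle
      (Nat.div_le_div_right (by omega)) (Nat.div_le_div_right (by omega))).bind ?_
    rintro Ls c'' ⟨hc'', hLs⟩
    refine Prog.Halts.pure ⟨?_, decode_level hR (k := k) (by omega) q ⟨p, _, _⟩ _ ?_ ?_⟩
    · have h4 : (d + 1 + 1) * (2 * ((R.card + 1) / B) + 4)
          = (d + 1) * (2 * ((R.card + 1) / B) + 4) + (2 * ((R.card + 1) / B) + 4) := by ring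
      omega
    · intro x h1 h2
      rw [hval]
      exact getD_drop_take _ _ _ _ h1 (by omega)
    · intro pre x (h1 : p ≤ x) h2 h3
      have hxw := h2.trans_le hq
      have h5 := hLs (node R k x) (idxAt R k x) (idxAt R k (x + 1)) (idxAt_mono h1 hxw.le)
        (idxAt_mono h2 hq) (siblings_children hxw)
      rw [hi x h1 (by omega), hi (x + 1) (by omega) (by omega), ← h3]
      exact ⟨h5.1, fun t ht => (h5.2 t ht).1⟩

include hL

theorem halts_provision (pre : List ℕ) (l : ℕ) (h : WithTop ℕ) (hk : pre.length < a) :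
    (provision B s a (width R 0) pre l h).Halts B disk (fun x c =>
      x.1.Pairwise (· ≤ ·) ∧
      (∀ t ∈ x.1, t ∈ R ∧ t.take pre.length = pre ∧ l ≤ t.getD pre.length 0 ∧
        (t.getD pre.length 0 : WithTop ℕ) ≤ h) ∧
      c ≤ a * (L + 3) + 2 * L + a * (2 * ((R.card + 1) / B) + 4)) := by
  unfold provision
  refine (halts_locate hB hR hL hval hidx pre [] 0 0 (width R 0) siblings_top (by omega)).bind ?_
  rintro ⟨lo, hi⟩ c₁ ⟨hs, hc₁⟩
  simp only [Nat.zero_add, List.nil_append] at hs ⊢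
  have hc₁' : c₁ ≤ a * (L + 3) := hc₁.trans (Nat.mul_le_mul_right _ hk.le)
  refine (halts_bsearchVal hB hL hval _ hs (fun w => l ≤ w)).bind ?_
  rintro p c₂ ⟨h1, h2, h3, -, h5⟩
  refine (halts_bsearchVal hB hL hval _ (hs.sub h1 h2 le_rfl)
    (fun w => h < (w : WithTop ℕ))).bind ?_
  rintro q c₃ ⟨h6, h7, -, h9, h10⟩
  split
  swap
  · exact Prog.Halts.pure ⟨List.Pairwise.nil, by simp, by omega⟩
  rename_i hpq
  obtain ⟨d, hd⟩ : ∃ d, a - pre.length = d + 1 := ⟨a - pre.length - 1, by omega⟩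
  rw [hd]
  refine (halts_copyLevels hB hR hval hidx d pre.length p q (by omega) h6
    (h7.trans hs.2.1)).bind ?_
  rintro Ls c₄ ⟨hc₄, hLs⟩
  obtain ⟨h11, h12⟩ := hLs pre p q le_rfl le_rfl (hs.sub h1 h6 h7)
  refine Prog.Halts.pure ⟨?_, ?_, ?_⟩
  · exact List.pairwise_map.2 (h11.imp fun h => (lex_append_le_append_iff pre).2 h)
  · intro t ht
    obtain ⟨t, ht', rfl⟩ := List.mem_map.1 ht
    obtain ⟨htR, x, hx1, hx2, hx3⟩ := h12 t ht'
    have h13 : (pre ++ t).getD pre.length 0 = valAt R pre.length x := by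
      cases t with
      | nil => simp at hx3
      | cons u t => simpa using hx3
    rw [h13]
    refine ⟨htR, by simp, (h3 (by omega)).trans (hs.valAt_le hR hk h1 hx1 (by omega)), ?_⟩
    exact (WithTop.coe_le_coe.2 (hs.valAt_le hR hk (by omega) (by omega : x ≤ q - 1)
      (by omega))).trans (not_lt.1 (h9 hpq))
  · have h14 : (d + 1) * (2 * ((R.card + 1) / B) + 4) ≤ a * (2 * ((R.card + 1) / B) + 4) :=
      Nat.mul_le_mul_right _ (by omega)
    simp only [add_zero]
    omega

end Specs

/-! ## Leapfrog Triejoin computes consistent assignments, without repetition -/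

theorem head_dropWhile_lt {mx z : ℕ} (u : List ℕ)
    (h : (u.dropWhile (fun w => decide (w < mx))).head? = some z) : mx ≤ z := by
  have h1 := List.head?_dropWhile_not (fun w => decide (w < mx)) u
  rw [h] at h1
  simpa using h1

/-- The iterators are kept in cyclic order of their heads with the maximum last. The invariant is
demanded only if the last iterator is nonempty, since an exhausted one ends the search. Running out
of fuel merely shortens the result, which does no harm to soundness. -/
theorem lfSearch_sound (fuel : ℕ) (l : List (List ℕ)) (hs : ∀ u ∈ l, u.Pairwise (· < ·))
    (hd : ∀ z, (l.getLastD []).head? = some z →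
      (∀ u ∈ l, u ≠ []) ∧ l.Pairwise (fun u v => u.headD 0 ≤ v.headD 0)) :
    (lfSearch fuel l).Pairwise (· < ·) ∧ ∀ v ∈ lfSearch fuel l, ∀ u ∈ l, v ∈ u := by
  induction fuel generalizing l with
  | zero => simp [lfSearch]
  | succ fuel ih =>
    cases l with
    | nil => simp [lfSearch]
    | cons it rest =>
      unfold lfSearch
      split
      · simp
      rename_i mx hmx
      obtain ⟨hne, hsort⟩ := hd mx hmx
      cases it with
      | nil => simp
      | cons v vs =>
        have hle : ∀ u ∈ (v :: vs) :: rest, u.headD 0 ≤ mx := by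
          intro u hu
          have hl : (((v :: vs) :: rest).getLast (by simp)).headD 0 = mx := by
            rw [List.getLastD_eq_getLast?, List.getLast?_eq_some_getLast (by simp)] at hmx
            rw [List.headD_eq_head?_getD]
            simp only [Option.getD_some] at hmx
            rw [hmx]; rfl
          rw [← List.dropLast_append_getLast (l := (v :: vs) :: rest) (by simp)] at hsort hu
          rw [List.pairwise_append] at hsort
          rcases List.mem_append.1 hu with hu | hu
          · exact (hsort.2.2 u hu _ (by simp)).trans hl.le
          · rw [List.mem_singleton.1 hu]; exact hl.le
        have hv := hs (v :: vs) (by simp)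
        rw [List.pairwise_cons] at hsort
        -- appending the advanced iterator preserves the invariant
        have step : ∀ w : List ℕ, w.Sublist (v :: vs) → (∀ z, w.head? = some z → mx ≤ z) →
            (lfSearch fuel (rest ++ [w])).Pairwise (· < ·) ∧
              ∀ x ∈ lfSearch fuel (rest ++ [w]), (∀ u ∈ rest, x ∈ u) ∧ x ∈ w := by
          intro w hw hz
          have h1 := ih (rest ++ [w]) ?_ ?_
          · exact ⟨h1.1, fun x hx => ⟨fun u hu => h1.2 x hx u (by simp [hu]),
              h1.2 x hx w (by simp)⟩⟩
          · intro u hu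
            rcases List.mem_append.1 hu with hu | hu
            · exact hs u (by simp [hu])
            · rw [List.mem_singleton.1 hu]; exact hv.sublist hw
          · intro z h2
            have h3 : w.head? = some z := by simpa using h2
            obtain ⟨w', rfl⟩ := List.head?_eq_some_iff.1 h3
            refine ⟨fun u hu => ?_, ?_⟩
            · rcases List.mem_append.1 hu with hu | hu
              · exact hne u (by simp [hu])
              · rw [List.mem_singleton.1 hu]; simp
            · refine List.pairwise_append.2 ⟨hsort.2, by simp, fun u hu b hb => ?_⟩
              rw [List.mem_singleton.1 hb]
              exact (hle u (by simp [hu])).trans (hz z rfl)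
        dsimp only
        split
        · rename_i hvm
          have hvs := (List.pairwise_cons.1 hv).1
          obtain ⟨h1, h2⟩ := step vs (List.sublist_cons_self v vs) (fun z hz => by
            obtain ⟨w', rfl⟩ := List.head?_eq_some_iff.1 hz
            exact hvm ▸ (hvs z (by simp)).le)
          refine ⟨List.pairwise_cons.2 ⟨fun x hx => hvs x (h2 x hx).2, h1⟩, ?_⟩
          intro x hx u hu
          -- The first head is the smallest and equals the largest, so all heads agree and the value
          -- emitted lies in every list.
          rcases List.mem_cons.1 hx with rfl | hx
          · rcases List.mem_cons.1 hu with rfl | hu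
            · simp
            · have h3 := hsort.1 u hu
              have h4 := hle u (by simp [hu])
              have h5 := hne u (by simp [hu])
              cases u with
              | nil => exact absurd rfl h5
              | cons y u =>
                simp only [List.headD_cons] at h3 h4
                have : x = y := by omega
                simp [this]
          · rcases List.mem_cons.1 hu with rfl | hu
            · exact List.mem_cons_of_mem _ (h2 x hx).2
            · exact (h2 x hx).1 u hu
        · obtain ⟨h1, h2⟩ := step ((v :: vs).dropWhile (fun w => decide (w < mx)))
            (List.dropWhile_sublist _) (fun z hz => head_dropWhile_lt _ hz)
          refine ⟨h1, fun x hx u hu => ?_⟩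
          rcases List.mem_cons.1 hu with rfl | hu
          · exact (List.dropWhile_sublist _).subset (h2 x hx).2
          · exact (h2 x hx).1 u hu

theorem leapfrog_sound (its : List (List ℕ)) (hs : ∀ u ∈ its, u.Pairwise (· < ·)) :
    (leapfrog its).Pairwise (· < ·) ∧ ∀ v ∈ leapfrog its, ∀ u ∈ its, v ∈ u := by
  unfold leapfrog
  split
  · simp
  rename_i hne
  have hmem : ∀ u, u ∈ its.insertionSort (fun u v => u.headD 0 ≤ v.headD 0) ↔ u ∈ its :=
    fun u => (List.perm_insertionSort _ its).mem_iff
  have h := lfSearch_sound ((its.map List.length).sum + 1)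
    (its.insertionSort (fun u v => u.headD 0 ≤ v.headD 0)) (fun u hu => hs u ((hmem u).1 hu)) ?_
  · exact ⟨h.1, fun v hv u hu => h.2 v hv u ((hmem u).2 hu)⟩
  · intro z _
    refine ⟨?_, ?_⟩
    · rintro u hu rfl
      exact hne (List.any_eq_true.2 ⟨[], (hmem []).1 hu, rfl⟩)
    · have : Std.Total (fun u v : List ℕ => u.headD 0 ≤ v.headD 0) :=
        ⟨fun u v => le_total _ _⟩
      have : IsTrans (List ℕ) (fun u v : List ℕ => u.headD 0 ≤ v.headD 0) :=
        ⟨fun u v w => le_trans⟩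
      exact List.pairwise_insertionSort _ its

/-- The tuples of a trie are in lexicographic order and have one component for each variable. -/
structure Trie.Wf (T : Trie) : Prop where
  vars_lt : T.vars.Pairwise (· < ·)
  sorted : T.tuples.Pairwise (· ≤ ·)
  length : ∀ t ∈ T.tuples, t.length = T.vars.length
  nil_mem : T.vars = [] → [] ∈ T.tuples

theorem Trie.Wf.keys_lt {T : Trie} (hT : T.Wf) : T.keys.Pairwise (· < ·) := by
  have h1 : T.keys.Pairwise (· ≤ ·) := by
    refine List.Pairwise.sublist (List.dedup_sublist _) (List.pairwise_map.2 (hT.sorted.imp ?_))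
    intro u v huv
    cases u with
    | nil => simp
    | cons a u =>
      cases v with
      | nil => exact absurd (List.nil_lt_cons a u) (not_lt.2 huv)
      | cons b v => rcases lex_cons_le_cons.1 huv with h | h <;> simp <;> omega
  exact (h1.and (List.nodup_dedup _)).imp fun h => lt_of_le_of_ne h.1 h.2

theorem Trie.mem_openAt_tuples {T : Trie} {v : ℕ} {t : List ℕ} :
    t ∈ (T.openAt v).tuples ↔ v :: t ∈ T.tuples := by
  simp only [Trie.openAt, List.mem_map, List.mem_filter, decide_eq_true_eq]
  constructor
  · rintro ⟨u, ⟨hu, huv⟩, rfl⟩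
    obtain ⟨w, rfl⟩ := List.head?_eq_some_iff.1 huv
    exact hu
  · exact fun h => ⟨_, ⟨h, rfl⟩, rfl⟩

theorem Trie.Wf.openAt {T : Trie} (hT : T.Wf) {x v : ℕ} {ys : List ℕ} (hx : T.vars = x :: ys)
    (hv : v ∈ T.keys) : (T.openAt v).Wf where
  vars_lt := hT.vars_lt.tail
  sorted := by
    refine List.pairwise_map.2 ((hT.sorted.filter _).imp_of_mem ?_)
    intro a b ha hb hab
    simp only [List.mem_filter, decide_eq_true_eq] at ha hb
    obtain ⟨a', rfl⟩ := List.head?_eq_some_iff.1 ha.2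
    obtain ⟨b', rfl⟩ := List.head?_eq_some_iff.1 hb.2
    simpa [lex_cons_le_cons] using hab
  length := by
    intro t ht
    have h := hT.length _ (Trie.mem_openAt_tuples.1 ht)
    simp only [Trie.openAt, hx, List.length_cons, List.tail_cons] at h ⊢
    omega
  nil_mem := by
    intro hnil
    rw [Trie.mem_openAt_tuples]
    simp only [Trie.keys, List.mem_dedup, List.mem_map] at hv
    obtain ⟨u, hu, rfl⟩ := hv
    have h := hT.length u hu
    have h2 : ys = [] := by simpa [Trie.openAt, hx] using hnil
    rw [hx, h2] at h
    obtain ⟨w, rfl⟩ := List.length_eq_one_iff.1 h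
    exact hu

/-- Position `y - x` of a result holds the value of variable `y`. Nodups at one level come from the
strictly increasing leapfrog output, and the consistency of a trie is settled when it has no
variables left, through `nil_mem`. -/
theorem lftj_sound (d x : ℕ) (Ts : List Trie) (hwf : ∀ T ∈ Ts, T.Wf)
    (hvars : ∀ T ∈ Ts, ∀ y ∈ T.vars, x ≤ y ∧ y < x + d) :
    (lftj d x Ts).Nodup ∧ ∀ t ∈ lftj d x Ts, t.length = d ∧
      ∀ T ∈ Ts, T.vars.map (fun y => t.getD (y - x) 0) ∈ T.tuples := by
  induction d generalizing x Ts with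
  | zero =>
    refine ⟨List.nodup_singleton _, fun t ht => ?_⟩
    obtain rfl := List.mem_singleton.1 ht
    refine ⟨rfl, fun T hT => ?_⟩
    have h : T.vars = [] := List.eq_nil_iff_forall_not_mem.2 fun y hy => by
      have := hvars T hT y hy
      omega
    rw [h]
    exact (hwf T hT).nil_mem h
  | succ d ih =>
    unfold lftj
    obtain ⟨h1, h2⟩ := leapfrog_sound
      ((Ts.filter (fun T : Trie => decide (T.vars.head? = some x))).map Trie.keys) (by
        intro u hu
        obtain ⟨T, hT, rfl⟩ := List.mem_map.1 hu
        exact (hwf T (List.mem_filter.1 hT).1).keys_lt)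
    have hkeys : ∀ v ∈ leapfrog
        ((Ts.filter (fun T : Trie => decide (T.vars.head? = some x))).map Trie.keys),
        ∀ T ∈ Ts, T.vars.head? = some x → v ∈ T.keys := fun v hv T hT hTx =>
      h2 v hv _ (List.mem_map.2 ⟨T, List.mem_filter.2 ⟨hT, by simpa using hTx⟩, rfl⟩)
    -- Variables of a trie increase, so if `x` is not its first variable it does not occur in it at
    -- all.
    have hrest : ∀ T ∈ Ts, T.vars.head? ≠ some x → ∀ y ∈ T.vars, x + 1 ≤ y := by
      intro T hT hTx y hy
      have hlt := (hwf T hT).vars_lt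
      have hv := hvars T hT
      cases h : T.vars with
      | nil => rw [h] at hy; simp at hy
      | cons z zs =>
        rw [h] at hlt hTx hv hy
        have h3 : z ≠ x := by simpa using hTx
        have h4 := hv z (by simp)
        rcases List.mem_cons.1 hy with rfl | hy
        · omega
        · have := (List.pairwise_cons.1 hlt).1 y hy
          omega
    have hIH := fun v hv => ih (x + 1)
      (Ts.map (fun T => if T.vars.head? = some x then T.openAt v else T)) (by
        intro T' hT'
        obtain ⟨T, hT, rfl⟩ := List.mem_map.1 hT'
        split
        · rename_i hx
          obtain ⟨ys, hys⟩ := List.head?_eq_some_iff.1 hx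
          exact (hwf T hT).openAt hys (hkeys v hv T hT hx)
        · exact hwf T hT) (by
        intro T' hT' y hy
        obtain ⟨T, hT, rfl⟩ := List.mem_map.1 hT'
        split at hy
        · rename_i hx
          obtain ⟨ys, hys⟩ := List.head?_eq_some_iff.1 hx
          have hlt := (hwf T hT).vars_lt
          have hy' : y ∈ ys := by simpa [Trie.openAt, hys] using hy
          have h3 := hvars T hT y (by rw [hys]; simp [hy'])
          rw [hys] at hlt
          have := (List.pairwise_cons.1 hlt).1 y hy'
          omega
        · rename_i hx
          have h3 := hvars T hT y hy
          have := hrest T hT hx y hy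
          omega)
    refine ⟨?_, fun t ht => ?_⟩
    · refine List.nodup_flatMap.2 ⟨fun v hv => ?_, ?_⟩
      · exact (hIH v hv).1.map fun a b hab => (List.cons.inj hab).2
      · refine h1.imp fun {v w} hvw => ?_
        rw [Function.onFun, List.disjoint_left]
        intro a ha hb
        obtain ⟨a', -, rfl⟩ := List.mem_map.1 ha
        obtain ⟨b', -, hab⟩ := List.mem_map.1 hb
        have := (List.cons.inj hab).1
        omega
    · obtain ⟨v, hv, ht⟩ := List.mem_flatMap.1 ht
      obtain ⟨t, ht', rfl⟩ := List.mem_map.1 ht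
      obtain ⟨hlen, hall⟩ := (hIH v hv).2 t ht'
      refine ⟨by simp [hlen], fun T hT => ?_⟩
      have h3 := hall _ (List.mem_map.2 ⟨T, hT, rfl⟩)
      -- Prepending the value of `x` moves the variables above `x` by one position.
      have hshift : ∀ ys : List ℕ, (∀ y ∈ ys, x + 1 ≤ y) →
          ys.map (fun y => (v :: t).getD (y - x) 0) = ys.map (fun y => t.getD (y - (x + 1)) 0) := by
        intro ys hys
        refine List.map_congr_left fun y hy => ?_
        have := hys y hy
        rw [show y - x = (y - (x + 1)) + 1 by omega, List.getD_cons_succ]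
      split at h3
      · rename_i hx
        obtain ⟨ys, hys⟩ := List.head?_eq_some_iff.1 hx
        have hlt := (hwf T hT).vars_lt
        rw [hys] at hlt
        rw [Trie.mem_openAt_tuples] at h3
        rw [hys, List.map_cons, hshift ys (fun y hy => (List.pairwise_cons.1 hlt).1 y hy)]
        simpa [Trie.openAt, hys] using h3
      · rename_i hx
        rw [hshift _ (hrest T hT hx)]
        exact h3

/-! ## Loops -/

namespace Prog

variable {F α β : Type} {B : ℕ} {disk : F → List ℕ}

theorem run_repeatUntil_inr {body : α → Prog F (α ⊕ β)} {s : α} {b : β} {c : ℕ} (k : ℕ)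
    (h : (body s).run B disk = some (Sum.inr b, c)) :
    (repeatUntil body (k + 1) s).run B disk = some (b, c) := by
  unfold repeatUntil
  refine run_bind (c' := 0) h ?_
  rfl

theorem run_repeatUntil_inl {body : α → Prog F (α ⊕ β)} {s s' : α} {b : β} {c c' : ℕ} (k : ℕ)
    (h : (body s).run B disk = some (Sum.inl s', c))
    (h' : (repeatUntil body k s').run B disk = some (b, c')) :
    (repeatUntil body (k + 1) s).run B disk = some (b, c + c') := by
  rw [repeatUntil]
  exact run_bind h h'

/-- A loop whose state consists of a lower bound and the output buffer.  The potential `Φ` decreases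
by `τ` in every round but the last, a round costs at most `Y` block reads, and `W` bounds the
number of words that are still to be written. -/
theorem halts_loop {body : ℕ → ℕ × List ℕ → Prog F ((ℕ × List ℕ) ⊕ List ℕ)} {ρ τ Y : ℕ}
    {Φ W : ℕ → ℕ} {J : ℕ → Prop}
    (step : ∀ low buf, J low → buf.length < B → ∃ res c,
      (∀ fuel ≥ ρ, (body fuel (low, buf)).run B disk = some (res, c)) ∧
      ((∃ buf', res = Sum.inr buf' ∧ buf'.length < B ∧
          B * c + buf'.length ≤ B * Y + buf.length + W low) ∨
        ∃ low' buf' w, res = Sum.inl (low', buf') ∧ J low' ∧ buf'.length < B ∧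
          Φ low' + τ ≤ Φ low ∧ w + W low' ≤ W low ∧
          B * c + buf'.length ≤ B * Y + buf.length + w))
    (r low : ℕ) (buf : List ℕ) (hJ : J low) (hbuf : buf.length < B) (hr : Φ low < r * τ) :
    ∃ buf' c, (∀ fuel ≥ ρ, ∀ k ≥ r,
        (repeatUntil (body fuel) k (low, buf)).run B disk = some (buf', c)) ∧
      buf'.length < B ∧ B * c + buf'.length ≤ B * (r * Y) + buf.length + W low := by
  induction r generalizing low buf with
  | zero => omega
  | succ r ih =>
    have hY : B * ((r + 1) * Y) = B * (r * Y) + B * Y := by ring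
    obtain ⟨res, c, hrun, hres⟩ := step low buf hJ hbuf
    rcases hres with ⟨buf', rfl, h1, h2⟩ | ⟨low', buf', w, rfl, hJ', h1, h2, h3, h4⟩
    · refine ⟨buf', c, fun fuel hf k hk => ?_, h1, by omega⟩
      obtain ⟨k, rfl⟩ : ∃ k', k = k' + 1 := ⟨k - 1, by omega⟩
      exact run_repeatUntil_inr k (hrun fuel hf)
    · rw [Nat.succ_mul] at hr
      obtain ⟨buf'', c', h5, h6, h7⟩ := ih low' buf' hJ' h1 (by omega)
      refine ⟨buf'', c + c', fun fuel hf k hk => ?_, h6, by rw [Nat.mul_add]; omega⟩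
      obtain ⟨k, rfl⟩ : ∃ k', k = k' + 1 := ⟨k - 1, by omega⟩
      exact run_repeatUntil_inl k (hrun fuel hf) (h5 fuel hf k (by omega))

end Prog

/-! ## Lists -/

theorem forall₂_exists {α β : Type*} {p : α → β → Prop} {l : List α} {l' : List β}
    (h : List.Forall₂ p l l') :
    (∀ a ∈ l, ∃ b ∈ l', p a b) ∧ ∀ b ∈ l', ∃ a ∈ l, p a b := by
  induction h with
  | nil => simp
  | cons h _ ih =>
    refine ⟨fun a ha => ?_, fun b hb => ?_⟩
    · rcases List.mem_cons.1 ha with rfl | ha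
      · exact ⟨_, by simp, h⟩
      · obtain ⟨b, hb, hab⟩ := ih.1 a ha
        exact ⟨b, by simp [hb], hab⟩
    · rcases List.mem_cons.1 hb with rfl | hb
      · exact ⟨_, by simp, h⟩
      · obtain ⟨a, ha, hab⟩ := ih.2 b hb
        exact ⟨a, by simp [ha], hab⟩

theorem foldr_min_spec {α : Type*} [LinearOrder α] [OrderTop α] (l : List α) :
    (∀ x ∈ l, l.foldr min ⊤ ≤ x) ∧ (l.foldr min ⊤ = ⊤ ∨ l.foldr min ⊤ ∈ l) := by
  induction l with
  | nil => simp
  | cons a l ih =>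
    simp only [List.foldr_cons, List.mem_cons, forall_eq_or_imp, min_le_left, true_and]
    refine ⟨fun x hx => (min_le_right _ _).trans (ih.1 x hx), ?_⟩
    rcases le_total a (l.foldr min ⊤) with h | h
    · rw [min_eq_left h]; exact Or.inr (Or.inl rfl)
    · rw [min_eq_right h]
      exact ih.2.imp id Or.inr

theorem sum_map_add_le {α : Type*} (f g : α → ℕ) (τ : ℕ) (l : List α) (h : ∀ x ∈ l, f x ≤ g x)
    (hx : ∃ x ∈ l, f x + τ ≤ g x) : (l.map f).sum + τ ≤ (l.map g).sum := by
  induction l with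
  | nil => simp at hx
  | cons a l ih =>
    simp only [List.map_cons, List.sum_cons]
    have h1 := h a (by simp)
    by_cases ha : f a + τ ≤ g a
    · have h2 := List.sum_le_sum (f := f) (g := g) fun x hx => h x (List.mem_cons_of_mem a hx)
      omega
    · obtain ⟨x, hx, hxa⟩ := hx
      rcases List.mem_cons.1 hx with rfl | hx
      · exact absurd hxa ha
      · have h2 := ih (fun x hx => h x (List.mem_cons_of_mem a hx)) ⟨x, hx, hxa⟩
        omega

/-! ## Queries as lists -/

namespace Query

variable {Q : Query} {I : Q.Input}

theorem length_of_mem_tuples {s : Fin Q.r} {t : List ℕ} (h : t ∈ Q.tuples I s) :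
    t.length = Q.arity s := by
  obtain ⟨u, -, rfl⟩ := Finset.mem_image.1 h
  simp

theorem card_tuples_le (s : Fin Q.r) : (Q.tuples I s).card ≤ Q.inputSize I :=
  Finset.card_image_le.trans
    (Finset.single_le_sum (f := fun s => (I s).card) (fun _ _ => Nat.zero_le _) (Finset.mem_univ s))

theorem length_atomVars (j : Fin Q.m) : (Q.atomVars j).length = Q.arity (Q.rel j) := by
  simp [atomVars]

theorem atomVars_lt (j : Fin Q.m) : (Q.atomVars j).Pairwise (· < ·) := by
  rw [atomVars, List.pairwise_ofFn]
  exact fun p q h => Q.vars_strictMono j h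

theorem lt_of_mem_atomVars {j : Fin Q.m} {y : ℕ} (h : y ∈ Q.atomVars j) : y < Q.n := by
  obtain ⟨p, rfl⟩ := (List.mem_ofFn' _ _).1 h
  exact (Q.vars j p).2

theorem arity_le (j : Fin Q.m) : Q.arity (Q.rel j) ≤ Q.n := by
  simpa using Fintype.card_le_of_injective _ (Q.vars_strictMono j).injective

/-- Every variable occurs in an atom, which confines its values to the projection of a finite
relation. -/
theorem finite_answer (Q : Query) (I : Q.Input) : (Q.answer I).Finite := by
  have h : ∀ x : Fin Q.n, ∃ V : Finset ℕ, ∀ t ∈ Q.answer I, t x ∈ V := by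
    intro x
    obtain ⟨j, p, rfl⟩ := Q.vars_cover x
    exact ⟨(I (Q.rel j)).image (fun u => u p), fun t ht =>
      Finset.mem_image.2 ⟨_, ht j, rfl⟩⟩
  choose V hV using h
  exact (Set.Finite.pi' fun x => (V x).finite_toSet).subset fun t ht x => hV x t ht

/-- The output tuples, as lists. -/
noncomputable def answerLists (Q : Query) (I : Q.Input) : Finset (List ℕ) :=
  (Q.finite_answer I).toFinset.image List.ofFn

theorem card_answerLists_le (Q : Query) (I : Q.Input) :
    (Q.answerLists I).card ≤ Q.outputSize I := by
  rw [outputSize, Set.ncard_eq_toFinset_card _ (Q.finite_answer I)]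
  exact Finset.card_image_le

theorem mem_answerLists {t : List ℕ} (hlen : t.length = Q.n)
    (h : ∀ j, (Q.atomVars j).map (fun y => t.getD y 0) ∈ Q.tuples I (Q.rel j)) :
    t ∈ Q.answerLists I := by
  refine Finset.mem_image.2 ⟨fun x => t.getD x 0, ?_, ?_⟩
  · rw [Set.Finite.mem_toFinset]
    intro j
    obtain ⟨u, hu, hut⟩ := Finset.mem_image.1 (h j)
    rw [atomVars, List.map_ofFn] at hut
    rw [List.ofFn_injective hut] at hu
    exact hu
  · refine List.ext_getElem (by simp [hlen]) fun i h1 h2 => ?_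
    simp [List.getElem?_eq_getElem h2]

end Query

/-! ## One round of the boxing procedure -/

section Round

variable {Q : Query} {I : Q.Input}

/-- A provisioned slice of the relation of atom `j`. -/
def IsSliceOf (I : Q.Input) (j : Fin Q.m) (T : Trie) : Prop :=
  T.vars = Q.atomVars j ∧ T.tuples.Pairwise (· ≤ ·) ∧ ∀ t ∈ T.tuples, t ∈ Q.tuples I (Q.rel j)

/-- The invariant of the boxing procedure on entering dimension `i`. -/
structure Inv (I : Q.Input) (i : ℕ) (spills : List (Pending Q)) (slices : List Trie) : Prop where
  nextVar_ge : ∀ A ∈ spills, ∃ y, A.nextVar = some y ∧ i ≤ y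
  length_le : spills.length + ∑ y ∈ Finset.Ico i Q.n, (preds Q y).length ≤ Q.m
  isSlice : ∀ T ∈ slices, ∃ j, IsSliceOf I j T
  covered : ∀ j, (∃ y, (Q.atomVars j).head? = some y ∧ i ≤ y) ∨ (∃ A ∈ spills, A.atom = j) ∨
    ∃ T ∈ slices, IsSliceOf I j T

open Classical in
/-- The output tuples that are compatible with the spilled prefixes and the provisioned slices. -/
noncomputable def box (I : Q.Input) (spills : List (Pending Q)) (slices : List Trie) :
    Finset (List ℕ) :=
  (Q.answerLists I).filter (fun t =>
    (∀ T ∈ slices, T.vars.map (fun y => t.getD y 0) ∈ T.tuples) ∧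
    ∀ A ∈ spills, ((Q.atomVars A.atom).take A.pre.length).map (fun y => t.getD y 0) = A.pre)

theorem mem_box {spills : List (Pending Q)} {slices : List Trie} {t : List ℕ} :
    t ∈ box I spills slices ↔ t ∈ Q.answerLists I ∧
      (∀ T ∈ slices, T.vars.map (fun y => t.getD y 0) ∈ T.tuples) ∧
      ∀ A ∈ spills,
        ((Q.atomVars A.atom).take A.pre.length).map (fun y => t.getD y 0) = A.pre := by
  simp [box]

theorem inv_zero (I : Q.Input) : Inv I 0 [] [] where
  nextVar_ge := by simp
  length_le := by
    have h : ∀ y, (preds Q y).length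
        = ((Finset.univ : Finset (Fin Q.m)).filter
          (fun j => (Q.atomVars j).head? = some y)).card := by
      intro y
      rw [preds, List.length_map, ← List.toFinset_card_of_nodup
        ((List.nodup_finRange Q.m).filter _)]
      congr 1
      ext j
      simp
    simp only [List.length_nil, zero_add, h]
    rw [← Finset.card_biUnion]
    · exact (Finset.card_le_univ _).trans (by simp)
    · intro y _ z _ hyz
      rw [Function.onFun, Finset.disjoint_left]
      intro j hj hj'
      simp only [Finset.mem_filter, Finset.mem_univ, true_and] at hj hj'
      exact hyz (Option.some.inj (hj.symm.trans hj'))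
  isSlice := by simp
  covered := by
    intro j
    refine Or.inl ?_
    cases h : Q.atomVars j with
    | nil =>
      have h1 := Query.length_atomVars j
      have h2 := Q.arity_pos (Q.rel j)
      rw [h] at h1
      simp at h1
      omega
    | cons y ys => exact ⟨y, rfl, Nat.zero_le _⟩

/-- The atoms that are handled at dimension `i`. -/
def active (i : ℕ) (spills : List (Pending Q)) : List (Pending Q) :=
  preds Q i ++ spills.filter (fun A => decide (A.nextVar = some i))

theorem mem_preds {i : ℕ} {A : Pending Q} :
    A ∈ preds Q i ↔ A.pre = [] ∧ (Q.atomVars A.atom).head? = some i := by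
  simp only [preds, List.mem_map, List.mem_filter, List.mem_finRange, true_and, decide_eq_true_eq]
  constructor
  · rintro ⟨j, hj, rfl⟩
    exact ⟨rfl, hj⟩
  · obtain ⟨j, pre⟩ := A
    rintro ⟨rfl, hj⟩
    exact ⟨j, hj, rfl⟩

theorem nextVar_of_mem_active {i : ℕ} {spills : List (Pending Q)} {A : Pending Q}
    (h : A ∈ active i spills) : A.nextVar = some i := by
  rcases List.mem_append.1 h with h | h
  · obtain ⟨h1, h2⟩ := mem_preds.1 h
    rw [Pending.nextVar, h1, ← h2, List.head?_eq_getElem?]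
    rfl
  · simpa using (List.mem_filter.1 h).2

/-- Spilled atoms and atoms not yet begun number at most `m` together. This is what bounds the
memory share of an active atom from below. -/
theorem Inv.length_active {i : ℕ} {spills : List (Pending Q)} {slices : List Trie}
    (h : Inv I i spills slices) (hi : i < Q.n) :
    (active i spills).length ≤ Q.m := by
  have h1 := h.length_le
  rw [Finset.sum_eq_sum_Ico_succ_bot hi] at h1
  have h2 := List.length_filter_le (fun A : Pending Q => decide (A.nextVar = some i)) spills
  rw [active, List.length_append]
  omega

/-- The slice of the atom `A` from `l` to `h` has more than `τ / D` tuples. -/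
def Heavy (I : Q.Input) (D τ : ℕ) (A : Pending Q) (l h : ℕ) : Prop :=
  τ < D * (slice (Q.tuples I (Q.rel A.atom)) A.pre l h).card

/-- The property of the result of probing the atom `A` from `low`. -/
structure ProbeSpec (I : Q.Input) (D τ low : ℕ) (A : Pending Q)
    (b : Pending Q × Option (WithTop ℕ)) : Prop where
  fst : b.1 = A
  none : b.2 = none → A.pre.length + 1 < Q.arity (Q.rel A.atom) ∧ Heavy I D τ A low low
  low_le : ∀ h, b.2 = some h → (low : WithTop ℕ) ≤ h
  some : ∀ h : ℕ, b.2 = some (h : WithTop ℕ) → Heavy I D τ A low (h + 1)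

/-- The property of the result of provisioning the atom `A` from `low` to `high`. -/
structure ProvisionSpec (I : Q.Input) (low : ℕ) (high : WithTop ℕ) (A : Pending Q)
    (x : Trie × ℕ) : Prop where
  slice : IsSliceOf I A.atom x.1
  bounds : ∀ t ∈ x.1.tuples, t.take A.pre.length = A.pre ∧ low ≤ t.getD A.pre.length 0 ∧
    (t.getD A.pre.length 0 : WithTop ℕ) ≤ high

theorem Heavy.mono {D τ : ℕ} {A : Pending Q} {l h h' : ℕ} (hA : Heavy I D τ A l h) (hh : h ≤ h') :
    Heavy I D τ A l h' :=
  lt_of_lt_of_le hA (Nat.mul_le_mul_left _ (Finset.card_le_card (slice_subset_slice _ _ hh)))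

/-- The upper bound that results from probing. -/
def upper (low : ℕ) (probes : List (Pending Q × Option (WithTop ℕ))) : WithTop ℕ :=
  (probes.map (fun Ah => Ah.2.getD (low : WithTop ℕ))).foldr min ⊤

/-- The spilled atoms, with their prefixes extended by `low`. -/
def spilled (low : ℕ) (probes : List (Pending Q × Option (WithTop ℕ))) : List (Pending Q) :=
  (probes.filter (fun Ah => Ah.2.isNone)).map
    (fun Ah => (⟨Ah.1.atom, Ah.1.pre ++ [low]⟩ : Pending Q))

/-- The atoms that have not spilled. -/
def fitting (probes : List (Pending Q × Option (WithTop ℕ))) : List (Pending Q) :=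
  (probes.filter (fun Ah => Ah.2.isSome)).map Prod.fst

section

variable {D τ low i : ℕ} {spills : List (Pending Q)} {slices : List Trie}
  {probes : List (Pending Q × Option (WithTop ℕ))} {provisioned : List (Trie × ℕ)}

theorem le_upper {atms : List (Pending Q)}
    (hp : List.Forall₂ (ProbeSpec I D τ low) atms probes) : (low : WithTop ℕ) ≤ upper low probes := by
  rcases (foldr_min_spec (probes.map (fun Ah => Ah.2.getD (low : WithTop ℕ)))).2 with h | h
  · rw [upper, h]; exact le_top
  · obtain ⟨b, hb, hbu⟩ := List.mem_map.1 h
    obtain ⟨A, -, hA⟩ := (forall₂_exists hp).2 b hb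
    rw [upper, ← hbu]
    cases hb2 : b.2 with
    | none => exact le_rfl
    | some h => exact hA.low_le h hb2

theorem upper_le {b : Pending Q × Option (WithTop ℕ)}
    (hb : b ∈ probes) : upper low probes ≤ b.2.getD (low : WithTop ℕ) :=
  (foldr_min_spec (probes.map (fun Ah => Ah.2.getD (low : WithTop ℕ)))).1 _
    (List.mem_map.2 ⟨b, hb, rfl⟩)

/-- A finite minimum is attained by some probe. Either that atom spilled, so that `h = low` and its
slice at `low` alone is heavy, or its own bound is `h` and the next value made the slice too large.
-/
theorem exists_heavy {atms : List (Pending Q)}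
    (hp : List.Forall₂ (ProbeSpec I D τ low) atms probes) {h : ℕ} (hh : upper low probes = h) :
    ∃ A ∈ atms, Heavy I D τ A low (h + 1) := by
  rcases (foldr_min_spec (probes.map (fun Ah => Ah.2.getD (low : WithTop ℕ)))).2 with h' | h'
  · rw [upper] at hh
    rw [hh] at h'
    exact absurd h' (WithTop.natCast_ne_top h)
  · obtain ⟨b, hb, hbu⟩ := List.mem_map.1 h'
    rw [← upper, hh] at hbu
    obtain ⟨A, hA, hAb⟩ := (forall₂_exists hp).2 b hb
    refine ⟨A, hA, ?_⟩
    cases hb2 : b.2 with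
    | none =>
      rw [hb2, Option.getD_none] at hbu
      have : low = h := Nat.cast_injective hbu
      exact (hAb.none hb2).2.mono (by omega)
    | some u =>
      rw [hb2, Option.getD_some] at hbu
      rw [hbu] at hb2
      exact hAb.some h hb2

/-- A spill collapses the round to the single value `low`, so a spilled atom constrains the current
variable as firmly as a provisioned slice does. -/
theorem exists_spilled_or_slice {atms : List (Pending Q)} {high : WithTop ℕ}
    (hp : List.Forall₂ (ProbeSpec I D τ low) atms probes)
    (hv : List.Forall₂ (ProvisionSpec I low high) (fitting probes) provisioned) {A : Pending Q}
    (hA : A ∈ atms) :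
    (⟨A.atom, A.pre ++ [low]⟩ ∈ spilled low probes ∧ upper low probes ≤ low) ∨
      ∃ x ∈ provisioned, ProvisionSpec I low high A x := by
  obtain ⟨b, hb, hAb⟩ := (forall₂_exists hp).1 A hA
  cases hb2 : b.2 with
  | none =>
    refine Or.inl ⟨List.mem_map.2 ⟨b, List.mem_filter.2 ⟨hb, by simp [hb2]⟩, ?_⟩, ?_⟩
    · rw [hAb.fst]
    · have := upper_le (low := low) hb
      rwa [hb2] at this
  | some h =>
    refine Or.inr ((forall₂_exists hv).1 A ?_)
    exact List.mem_map.2 ⟨b, List.mem_filter.2 ⟨hb, by simp [hb2]⟩, hAb.fst⟩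

theorem getElem?_of_nextVar {A : Pending Q} (h : A.nextVar = some i) :
    (Q.atomVars A.atom)[A.pre.length]? = some i := h

/-- A spill happens only before the last level, so the next variable exists, and it exceeds `i`
because variables follow the key order. An active atom leaves the round either as a spill or as a
slice, so the count does not grow and coverage is kept. -/
theorem Inv.succ {high : WithTop ℕ} (hi : i < Q.n) (h : Inv I i spills slices)
    (hp : List.Forall₂ (ProbeSpec I D τ low) (active i spills) probes)
    (hv : List.Forall₂ (ProvisionSpec I low high) (fitting probes) provisioned) :
    Inv I (i + 1) (spills.filter (fun A => decide (A.nextVar ≠ some i)) ++ spilled low probes)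
      (slices ++ provisioned.map Prod.fst) where
  nextVar_ge := by
    intro A hA
    rcases List.mem_append.1 hA with hA | hA
    · obtain ⟨hA, hne⟩ := List.mem_filter.1 hA
      obtain ⟨y, hy, hiy⟩ := h.nextVar_ge A hA
      have hyi : y ≠ i := by
        rintro rfl
        simp [hy] at hne
      exact ⟨y, hy, by omega⟩
    · obtain ⟨b, hb, rfl⟩ := List.mem_map.1 hA
      obtain ⟨hb, hnone⟩ := List.mem_filter.1 hb
      obtain ⟨A, hA, hAb⟩ := (forall₂_exists hp).2 b hb
      have hlen := (hAb.none (by simpa using hnone)).1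
      rw [← Query.length_atomVars] at hlen
      have hnext := getElem?_of_nextVar (nextVar_of_mem_active hA)
      obtain ⟨h1, h2⟩ := List.getElem?_eq_some_iff.1 hnext
      have hlt := List.pairwise_iff_getElem.1 (Query.atomVars_lt A.atom) _ _ h1 hlen (by omega)
      refine ⟨(Q.atomVars A.atom)[A.pre.length + 1], ?_, by omega⟩
      simp only [Pending.nextVar, hAb.fst, List.length_append, List.length_singleton]
      exact List.getElem?_eq_getElem hlen
  length_le := by
    have h1 := h.length_le
    rw [Finset.sum_eq_sum_Ico_succ_bot hi] at h1
    have h2 : (spilled low probes).length ≤ (active i spills).length := by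
      rw [spilled, List.length_map, hp.length_eq]
      exact List.length_filter_le _ _
    have h3 := List.length_eq_length_filter_add (l := spills)
      (fun A : Pending Q => decide (A.nextVar = some i))
    have h4 : (spills.filter (fun A => decide (A.nextVar ≠ some i)))
        = spills.filter (fun A => !decide (A.nextVar = some i)) := by
      congr 1
      funext A
      simp
    rw [active, List.length_append] at h2
    rw [List.length_append, h4]
    omega
  isSlice := by
    intro T hT
    rcases List.mem_append.1 hT with hT | hT
    · exact h.isSlice T hT
    · obtain ⟨x, hx, rfl⟩ := List.mem_map.1 hT
      obtain ⟨A, -, hA⟩ := (forall₂_exists hv).2 x hx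
      exact ⟨_, hA.slice⟩
  covered := by
    have hact : ∀ A ∈ active i spills,
        (∃ A' ∈ spills.filter (fun A => decide (A.nextVar ≠ some i)) ++ spilled low probes,
          A'.atom = A.atom) ∨
        ∃ T ∈ slices ++ provisioned.map Prod.fst, IsSliceOf I A.atom T := by
      intro A hA
      rcases exists_spilled_or_slice hp hv hA with ⟨h1, -⟩ | ⟨x, hx, hxA⟩
      · exact Or.inl ⟨_, List.mem_append_right _ h1, rfl⟩
      · exact Or.inr ⟨x.1, List.mem_append_right _ (List.mem_map_of_mem hx), hxA.slice⟩
    intro j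
    rcases h.covered j with ⟨y, hy, hiy⟩ | ⟨A, hA, rfl⟩ | ⟨T, hT, hTj⟩
    · rcases hiy.eq_or_lt with rfl | hiy
      · exact Or.inr (hact ⟨j, []⟩ (List.mem_append_left _ (mem_preds.2 ⟨rfl, hy⟩)))
      · exact Or.inl ⟨y, hy, hiy⟩
    · by_cases hn : A.nextVar = some i
      · exact Or.inr (hact A (List.mem_append_right _ (List.mem_filter.2 ⟨hA, by simpa using hn⟩)))
      · exact Or.inr (Or.inl ⟨A, List.mem_append_left _
          (List.mem_filter.2 ⟨hA, by simpa using hn⟩), rfl⟩)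
    · exact Or.inr (Or.inr ⟨T, List.mem_append_left _ hT, hTj⟩)

/-- An output tuple in the box of a round agrees with the prefix of each atom that is handled in
this round, and its component at the current dimension lies between the bounds. -/
theorem active_of_mem_box
    (hp : List.Forall₂ (ProbeSpec I D τ low) (active i spills) probes)
    (hv : List.Forall₂ (ProvisionSpec I low (upper low probes)) (fitting probes) provisioned)
    {t : List ℕ} (ht : t ∈ box I
      (spills.filter (fun A => decide (A.nextVar ≠ some i)) ++ spilled low probes)
      (slices ++ provisioned.map Prod.fst)) {A : Pending Q} (hA : A ∈ active i spills) :
    ((Q.atomVars A.atom).take A.pre.length).map (fun y => t.getD y 0) = A.pre ∧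
      low ≤ t.getD i 0 ∧ (t.getD i 0 : WithTop ℕ) ≤ upper low probes := by
  obtain ⟨-, ht1, ht2⟩ := mem_box.1 ht
  obtain ⟨hk, hki⟩ := List.getElem?_eq_some_iff.1 (getElem?_of_nextVar (nextVar_of_mem_active hA))
  rcases exists_spilled_or_slice hp hv hA with ⟨h1, h2⟩ | ⟨x, hx, hxA⟩
  · have h3 := ht2 _ (List.mem_append_right _ h1)
    simp only [List.length_append, List.length_singleton] at h3
    -- The extended prefix splits into the old prefix and the entry `low` for variable `i`.
    rw [List.take_succ_eq_append_getElem hk, List.map_append, hki] at h3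
    obtain ⟨h4, h5⟩ := List.append_inj' h3 rfl
    have h6 : t.getD i 0 = low := by simpa using h5
    refine ⟨h4, h6.ge, ?_⟩
    rw [h6]
    exact le_upper hp
  · have h3 := ht1 x.1 (List.mem_append_right _ (List.mem_map_of_mem hx))
    have h4 := hxA.bounds _ h3
    rw [hxA.slice.1, ← List.map_take] at h4
    have h5 : ((Q.atomVars A.atom).map (fun y => t.getD y 0)).getD A.pre.length 0
        = t.getD i 0 := by
      rw [List.getD_eq_getElem _ _ (by simpa using hk), List.getElem_map, hki]
    rw [h5] at h4
    exact h4

theorem box_round_subset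
    (hp : List.Forall₂ (ProbeSpec I D τ low) (active i spills) probes)
    (hv : List.Forall₂ (ProvisionSpec I low (upper low probes)) (fitting probes) provisioned) :
    box I (spills.filter (fun A => decide (A.nextVar ≠ some i)) ++ spilled low probes)
      (slices ++ provisioned.map Prod.fst) ⊆ box I spills slices := by
  intro t ht
  obtain ⟨ht0, ht1, ht2⟩ := mem_box.1 ht
  refine mem_box.2 ⟨ht0, fun T hT => ht1 T (List.mem_append_left _ hT), fun A hA => ?_⟩
  by_cases hn : A.nextVar = some i
  · exact (active_of_mem_box hp hv ht
      (List.mem_append_right _ (List.mem_filter.2 ⟨hA, by simpa using hn⟩))).1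
  · exact ht2 A (List.mem_append_left _ (List.mem_filter.2 ⟨hA, by simpa using hn⟩))

end

/-! ### The potential of a loop -/

/-- The tuples that start with `pre` and whose next component is at least `l`. -/
def sliceFrom (R : Finset (List ℕ)) (pre : List ℕ) (l : ℕ) : Finset (List ℕ) :=
  R.filter (fun t => t.take pre.length = pre ∧ l ≤ t.getD pre.length 0)

theorem card_sliceFrom_add_le (R : Finset (List ℕ)) (pre : List ℕ) {l h : ℕ} (hlh : l ≤ h) :
    (sliceFrom R pre (h + 1)).card + (slice R pre l h).card ≤ (sliceFrom R pre l).card := by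
  rw [← Finset.card_union_of_disjoint]
  · refine Finset.card_le_card fun t ht => ?_
    simp only [sliceFrom, slice, Finset.mem_union, Finset.mem_filter] at ht ⊢
    rcases ht with ⟨h1, h2, h3⟩ | ⟨h1, h2, h3, h4⟩
    · exact ⟨h1, h2, by omega⟩
    · exact ⟨h1, h2, h3⟩
  · rw [Finset.disjoint_left]
    intro t ht ht'
    simp only [sliceFrom, slice, Finset.mem_filter] at ht ht'
    omega

theorem card_slice_le (R : Finset (List ℕ)) (pre : List ℕ) {l h : ℕ} (hlh : l ≤ h) :
    (slice R pre l (h + 1)).card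
      ≤ (slice R pre l h).card + (slice R pre (l + 1) (h + 1)).card := by
  refine le_trans (Finset.card_le_card fun t ht => ?_) (Finset.card_union_le _ _)
  simp only [slice, Finset.mem_union, Finset.mem_filter] at ht ⊢
  rcases Nat.lt_or_ge h (t.getD pre.length 0) with h' | h'
  · exact Or.inr ⟨ht.1, ht.2.1, by omega, ht.2.2.2⟩
  · exact Or.inl ⟨ht.1, ht.2.1, ht.2.2.1, h'⟩

/-- The contribution of the atom `A` to the potential. -/
def weight (I : Q.Input) (low : ℕ) (A : Pending Q) : ℕ :=
  (sliceFrom (Q.tuples I (Q.rel A.atom)) A.pre low).card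
    + (sliceFrom (Q.tuples I (Q.rel A.atom)) A.pre (low + 1)).card

/-- A round covers `[l, h]` but only `[l, h + 1]` is known to be heavy, and `h + 1` is met again in
the next round. The first summand of the weight loses `[l, h]` and the second loses `[l + 1, h +
1]`; together these cover `[l, h + 1]`. -/
theorem weight_add_le (A : Pending Q) {l h : ℕ} (hlh : l ≤ h) :
    weight I (h + 1) A + (slice (Q.tuples I (Q.rel A.atom)) A.pre l (h + 1)).card
      ≤ weight I l A := by
  have h1 := card_sliceFrom_add_le (Q.tuples I (Q.rel A.atom)) A.pre hlh
  have h2 := card_sliceFrom_add_le (Q.tuples I (Q.rel A.atom)) A.pre (Nat.succ_le_succ hlh)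
  have h3 := card_slice_le (Q.tuples I (Q.rel A.atom)) A.pre hlh
  simp only [weight, Nat.succ_eq_add_one] at *
  omega

theorem weight_le (low : ℕ) (A : Pending Q) : weight I low A ≤ 2 * Q.inputSize I := by
  have h := Query.card_tuples_le (I := I) (Q.rel A.atom)
  have h1 := fun l => Finset.card_filter_le (Q.tuples I (Q.rel A.atom))
    (fun t => t.take A.pre.length = A.pre ∧ l ≤ t.getD A.pre.length 0)
  have h2 := h1 low
  have h3 := h1 (low + 1)
  rw [weight, sliceFrom, sliceFrom]
  omega

/-- The potential of the loop over the atoms `atms`. -/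
def potential (I : Q.Input) (D : ℕ) (atms : List (Pending Q)) (low : ℕ) : ℕ :=
  (atms.map (fun A => D * weight I low A)).sum

theorem potential_add_le {D τ : ℕ} {atms : List (Pending Q)} {l h : ℕ} (hlh : l ≤ h)
    (hA : ∃ A ∈ atms, Heavy I D τ A l (h + 1)) :
    potential I D atms (h + 1) + τ ≤ potential I D atms l := by
  refine sum_map_add_le _ _ τ atms (fun A _ => ?_) ?_
  · have := weight_add_le (I := I) A hlh
    exact Nat.mul_le_mul_left _ (by omega)
  · obtain ⟨A, hA, hheavy⟩ := hA
    refine ⟨A, hA, ?_⟩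
    have := Nat.mul_le_mul_left D (weight_add_le (I := I) A hlh)
    rw [Nat.mul_add] at this
    exact (Nat.add_le_add_left hheavy.le _).trans this

theorem potential_le {D : ℕ} {atms : List (Pending Q)} (h : atms.length ≤ Q.m) (low : ℕ) :
    potential I D atms low ≤ 2 * Q.m * D * Q.inputSize I := by
  have h1 : potential I D atms low ≤ atms.length * (D * (2 * Q.inputSize I)) := by
    rw [potential, ← List.length_map (as := atms) (f := fun A => D * weight I low A), ← smul_eq_mul]
    refine List.sum_le_card_nsmul _ _ fun x hx => ?_
    obtain ⟨A, -, rfl⟩ := List.mem_map.1 hx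
    exact Nat.mul_le_mul_left _ (weight_le low A)
  refine h1.trans ((Nat.mul_le_mul_right _ h).trans (le_of_eq (by ring)))

end Round

/-! ## The cost of the boxing procedure -/

/-- A bound on the cost of probing and provisioning in one round, for `m` atoms over `n` variables
and `S < 2 ^ L` tuples. -/
def roundCost (n m L S B : ℕ) : ℕ :=
  m * (n * (3 * L + 3) + L + 1) + m * (n * (L + 3) + 2 * L + n * (2 * ((S + 1) / B) + 4))

/-- A bound on the number of block reads, when `d` dimensions remain and each loop has at most `r`
rounds. -/
def readCost (r X : ℕ) : ℕ → ℕ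
  | 0 => 0
  | d + 1 => r * (X + readCost r X d)

section

variable {Q : Query} {I : Q.Input} {L D τ : ℕ} {P : Params Q}

theorem halts_probeAtom (hB : 1 ≤ P.B) (hL : Q.inputSize I < 2 ^ L)
    (hN : ∀ s, P.N s = width (Q.tuples I s) 0) {low mem : ℕ} (hmem : 1 ≤ mem)
    (hD : ∀ x, mem * P.B < 3 * Q.n * x → τ < D * x) {A : Pending Q}
    (hA : A.pre.length < Q.arity (Q.rel A.atom)) :
    (probeAtom P low mem A).Halts P.B (Q.disk I) (fun b c =>
      ProbeSpec I D τ low A b ∧ c ≤ Q.n * (3 * L + 3) + L + 1) := by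
  have hn := Query.arity_le A.atom
  have heavy : ∀ l h, mem * P.B < 3 * Q.arity (Q.rel A.atom) *
      (slice (Q.tuples I (Q.rel A.atom)) A.pre l h).card → Heavy I D τ A l h := fun l h hx =>
    hD _ (hx.trans_le (Nat.mul_le_mul_right _ (by omega)))
  unfold probeAtom
  dsimp only
  rw [hN]
  refine (halts_probe hB (fun t ht => Query.length_of_mem_tuples ht)
    ((Query.card_tuples_le _).trans_lt hL) (fun _ => rfl) (fun _ => rfl) A.pre low mem hA
    hmem).bind ?_
  rintro o c ⟨h1, h2, h3, h4⟩
  refine Prog.Halts.pure ⟨⟨rfl, fun ho => ⟨(h1 ho).1, heavy _ _ (h1 ho).2⟩, h2,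
    fun h ho => heavy _ _ (h3 h ho)⟩, ?_⟩
  have : Q.arity (Q.rel A.atom) * (3 * L + 3) ≤ Q.n * (3 * L + 3) := Nat.mul_le_mul_right _ hn
  omega

theorem halts_provisionAtom (hB : 1 ≤ P.B) (hL : Q.inputSize I < 2 ^ L)
    (hN : ∀ s, P.N s = width (Q.tuples I s) 0) {low : ℕ} {high : WithTop ℕ} {A : Pending Q}
    (hA : A.pre.length < Q.arity (Q.rel A.atom)) :
    (provisionAtom P low high A).Halts P.B (Q.disk I) (fun x c =>
      ProvisionSpec I low high A x ∧
      c ≤ Q.n * (L + 3) + 2 * L + Q.n * (2 * ((Q.inputSize I + 1) / P.B) + 4)) := by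
  have hn := Query.arity_le A.atom
  unfold provisionAtom
  dsimp only
  rw [hN]
  refine (halts_provision hB (fun t ht => Query.length_of_mem_tuples ht)
    ((Query.card_tuples_le _).trans_lt hL) (fun _ => rfl) (fun _ => rfl) A.pre low high hA).bind ?_
  rintro ⟨ts, used⟩ c ⟨h1, h2, h3⟩
  refine Prog.Halts.pure ⟨⟨⟨rfl, h1, fun t ht => (h2 t ht).1⟩, fun t ht => (h2 t ht).2⟩, ?_⟩
  have h4 : Q.arity (Q.rel A.atom) * (L + 3) ≤ Q.n * (L + 3) := Nat.mul_le_mul_right _ hn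
  have h5 : ((Q.tuples I (Q.rel A.atom)).card + 1) / P.B ≤ (Q.inputSize I + 1) / P.B :=
    Nat.div_le_div_right (Nat.add_le_add_right (Query.card_tuples_le _) 1)
  have h6 : Q.arity (Q.rel A.atom) * (2 * (((Q.tuples I (Q.rel A.atom)).card + 1) / P.B) + 4)
      ≤ Q.n * (2 * ((Q.inputSize I + 1) / P.B) + 4) := Nat.mul_le_mul hn (by omega)
  omega

theorem length_pre_lt {i : ℕ} {A : Pending Q} (h : A.nextVar = some i) :
    A.pre.length < Q.arity (Q.rel A.atom) := by
  rw [← Query.length_atomVars]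
  exact (List.getElem?_eq_some_iff.1 (getElem?_of_nextVar h)).1

theorem Trie.wf_of_isSliceOf {j : Fin Q.m} {T : Trie} (h : IsSliceOf I j T) : T.Wf where
  vars_lt := h.1 ▸ Query.atomVars_lt j
  sorted := h.2.1
  length := fun t ht => by
    rw [h.1, Query.length_atomVars, Query.length_of_mem_tuples (h.2.2 t ht)]
  nil_mem := fun hnil => by
    have h1 := Query.length_atomVars j
    have h2 := Q.arity_pos (Q.rel j)
    rw [← h.1, hnil] at h1
    simp at h1
    omega

/-- With no dimension left and nothing spilled, every atom has a slice, so each tuple found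
satisfies all atoms and lies in the box. The tuples are distinct and take `n` words each. -/
theorem length_flatten_lftj_le {slices : List Trie} (h : Inv I Q.n [] slices) :
    (lftj Q.n 0 slices).flatten.length ≤ Q.n * (box I [] slices).card := by
  obtain ⟨h1, h2⟩ := lftj_sound Q.n 0 slices
    (fun T hT => let ⟨_, hj⟩ := h.isSlice T hT; Trie.wf_of_isSliceOf hj) (fun T hT y hy => by
      obtain ⟨j, hj⟩ := h.isSlice T hT
      rw [hj.1] at hy
      exact ⟨Nat.zero_le _, by simpa using Query.lt_of_mem_atomVars hy⟩)
  have h3 : (lftj Q.n 0 slices).toFinset ⊆ box I [] slices := by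
    intro t ht
    obtain ⟨hlen, hall⟩ := h2 t (List.mem_toFinset.1 ht)
    simp only [Nat.sub_zero] at hall
    refine mem_box.2 ⟨Query.mem_answerLists hlen fun j => ?_, hall, by simp⟩
    rcases h.covered j with ⟨y, hy, hny⟩ | ⟨A, hA, -⟩ | ⟨T, hT, hTj⟩
    · have := Query.lt_of_mem_atomVars (List.mem_of_mem_head? hy)
      omega
    · simp at hA
    · rw [← hTj.1]
      exact hTj.2.2 _ (hall T hT)
  have h4 := Finset.card_le_card h3
  rw [List.toFinset_card_of_nodup h1] at h4
  rw [List.length_flatten, Nat.mul_comm]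
  refine le_trans (List.sum_le_card_nsmul _ Q.n ?_) ?_
  · intro x hx
    obtain ⟨t, ht, rfl⟩ := List.mem_map.1 hx
    exact (h2 t ht).1.le
  · rw [List.length_map, smul_eq_mul]
    exact Nat.mul_le_mul_right _ h4

end

section

variable {Q : Query} {I : Q.Input} {L D B memMax : ℕ}

/-- A round of the loop at a dimension, when `d` further dimensions remain. -/
def boxRound (P : Params Q) (d i leftover : ℕ) (spills : List (Pending Q)) (slices : List Trie)
    (st : ℕ × List ℕ) : Prog (File Q.r) ((ℕ × List ℕ) ⊕ List ℕ) := do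
  let probes ← Prog.seq ((active i spills).map (probeAtom P st.1
    ((P.memMax / Q.n + leftover) / (active i spills).length)))
  let provisioned ← Prog.seq ((fitting probes).map (provisionAtom P st.1 (upper st.1 probes)))
  let buf ← boxUp P d (i + 1) (P.memMax / Q.n + leftover - (provisioned.map Prod.snd).sum)
    (spills.filter (fun A => decide (A.nextVar ≠ some i)) ++ spilled st.1 probes)
    (slices ++ provisioned.map Prod.fst) st.2
  if upper st.1 probes = ⊤ then return Sum.inr buf
  else return Sum.inl ((upper st.1 probes).untopD 0 + 1, buf)

/-- `leftover` is arbitrary because only a lower bound on the shares is used, so no account of the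
memory in use is needed. The hypothesis `hD` says that a slice too large for the least possible
share has more than `|I| / D` tuples. -/
theorem halts_boxUp (hB : 1 ≤ B) (hI : 0 < Q.inputSize I) (hL : Q.inputSize I < 2 ^ L)
    (hmem : Q.m ≤ memMax / Q.n)
    (hD : ∀ x, memMax / Q.n / Q.m * B < 3 * Q.n * x → Q.inputSize I < D * x)
    (d i leftover : ℕ) (hdi : i + d = Q.n) (spills : List (Pending Q)) (slices : List Trie)
    (buf : List ℕ) (hinv : Inv I i spills slices) (hbuf : buf.length < B) :
    ∃ buf' c, (∀ fuel ≥ 2 * Q.m * D + 1,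
        (boxUp ⟨B, memMax, fuel, fun s => (valArray (Q.tuples I s) 0).length⟩ d i leftover spills
          slices buf).run B (Q.disk I) = some (buf', c)) ∧
      buf'.length < B ∧ B * c + buf'.length ≤
        B * readCost (2 * Q.m * D + 1) (roundCost Q.n Q.m L (Q.inputSize I) B) d + buf.length
          + Q.n * (box I spills slices).card := by
  induction d generalizing i leftover spills slices buf with
  | zero =>
    obtain rfl : i = Q.n := by omega
    -- A spilled atom would have a next variable that is at least `n`.
    have hnil : spills = [] := by
      refine List.eq_nil_iff_forall_not_mem.2 fun A hA => ?_
      obtain ⟨y, hy, hny⟩ := hinv.nextVar_ge A hA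
      have := Query.lt_of_mem_atomVars (List.mem_of_getElem? (getElem?_of_nextVar hy))
      omega
    subst hnil
    obtain ⟨buf', c, h1, h2, h3⟩ := Prog.halts_appendOut (disk := Q.disk I) hB
      (lftj Q.n 0 slices).flatten buf hbuf
    refine ⟨buf', c, fun fuel _ => ?_, h2, ?_⟩
    · simpa [boxUp] using h1
    · have := length_flatten_lftj_le hinv
      rw [readCost]
      omega
  | succ d ih =>
    have hi : i < Q.n := by omega
    have hact := hinv.length_active hi
    have hshare : ∀ A ∈ active i spills,
        memMax / Q.n / Q.m ≤ (memMax / Q.n + leftover) / (active i spills).length ∧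
        1 ≤ memMax / Q.n / Q.m := by
      intro A hA
      have h1 := List.length_pos_of_mem hA
      exact ⟨(Nat.div_le_div_left hact h1).trans (Nat.div_le_div_right (by omega)),
        (Nat.one_le_div_iff (by omega)).2 hmem⟩
    set Y := roundCost Q.n Q.m L (Q.inputSize I) B
      + readCost (2 * Q.m * D + 1) (roundCost Q.n Q.m L (Q.inputSize I) B) d with hY
    -- `J` covers dimensions without active atoms: there the bound is `⊤` at once and the only round
    -- starts at `0`. `W` counts the words of the box tuples whose component at `i` has not been
    -- passed.
    refine Exists.elim (Prog.halts_loop (disk := Q.disk I) (ρ := 2 * Q.m * D + 1)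
      (τ := Q.inputSize I) (Y := Y) (Φ := potential I D (active i spills))
      (W := fun low => Q.n * ((box I spills slices).filter (fun t => low ≤ t.getD i 0)).card)
      (J := fun low => active i spills ≠ [] ∨ low = 0)
      (body := fun fuel => boxRound ⟨B, memMax, fuel, fun s => (valArray (Q.tuples I s) 0).length⟩
        d i leftover spills slices) ?_ (2 * Q.m * D + 1) 0 buf (Or.inr rfl) hbuf ?_) ?_
    · intro low buf hJ hbuf
      -- Probing and provisioning contain no fuelled loop, so the fuel `0` stands for any fuel here.
      obtain ⟨probes, c₁, hrun₁, hp, hc₁⟩ := Prog.halts_seq (disk := Q.disk I) (B := B)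
        (f := probeAtom ⟨B, memMax, 0, fun s => (valArray (Q.tuples I s) 0).length⟩ low
          ((memMax / Q.n + leftover) / (active i spills).length))
        (Φ := ProbeSpec I D (Q.inputSize I) low) (active i spills) (fun A hA =>
          halts_probeAtom (P := ⟨B, memMax, 0, fun s => (valArray (Q.tuples I s) 0).length⟩) hB hL
            (fun s => length_valArray (R := Q.tuples I s) 0) ((hshare A hA).2.trans (hshare A hA).1)
            (fun x hx => hD x ((Nat.mul_le_mul_right _ (hshare A hA).1).trans_lt hx))
            (length_pre_lt (nextVar_of_mem_active hA)))
      have hfit : ∀ A ∈ fitting probes, A ∈ active i spills := by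
        intro A hA
        obtain ⟨b, hb, rfl⟩ := List.mem_map.1 hA
        obtain ⟨A, hA, hAb⟩ := (forall₂_exists hp).2 b (List.mem_filter.1 hb).1
        rwa [hAb.fst]
      have hfitlen : (fitting probes).length ≤ Q.m := by
        rw [fitting, List.length_map]
        exact (List.length_filter_le _ _).trans (hp.length_eq ▸ hact)
      obtain ⟨provisioned, c₂, hrun₂, hv, hc₂⟩ := Prog.halts_seq (disk := Q.disk I) (B := B)
        (f := provisionAtom ⟨B, memMax, 0, fun s => (valArray (Q.tuples I s) 0).length⟩ low
          (upper low probes))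
        (Φ := ProvisionSpec I low (upper low probes)) (fitting probes) (fun A hA =>
          halts_provisionAtom (P := ⟨B, memMax, 0, fun s => (valArray (Q.tuples I s) 0).length⟩)
            hB hL (fun s => length_valArray (R := Q.tuples I s) 0) (length_pre_lt (nextVar_of_mem_active (hfit A hA))))
      obtain ⟨buf', c₃, hrun₃, hbuf', hc₃⟩ := ih (i + 1)
        (memMax / Q.n + leftover - (provisioned.map Prod.snd).sum) (by omega) _ _ buf
        (hinv.succ hi hp hv) hbuf
      have hc₁₂ : c₁ + c₂ ≤ roundCost Q.n Q.m L (Q.inputSize I) B :=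
        Nat.add_le_add (hc₁.trans (Nat.mul_le_mul_right _ hact))
          (hc₂.trans (Nat.mul_le_mul_right _ hfitlen))
      have hBc : B * (c₁ + (c₂ + (c₃ + 0))) = B * (c₁ + c₂) + B * c₃ := by ring
      have hBY := Nat.mul_le_mul_left B hc₁₂
      have hsub := box_round_subset (slices := slices) hp hv
      set newBox := box I (spills.filter (fun A => decide (A.nextVar ≠ some i))
        ++ spilled low probes) (slices ++ provisioned.map Prod.fst) with hnew
      have hlow : ∀ t ∈ newBox, low ≤ t.getD i 0 := by
        intro t ht
        rcases hJ with hJ | rfl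
        · obtain ⟨A, hA⟩ := List.exists_mem_of_ne_nil _ hJ
          exact (active_of_mem_box hp hv ht hA).2.1
        · exact Nat.zero_le _
      have hsub' : newBox ⊆ (box I spills slices).filter (fun t => low ≤ t.getD i 0) :=
        fun t ht => Finset.mem_filter.2 ⟨hsub ht, hlow t ht⟩
      rw [hY, Nat.mul_add B]
      by_cases htop : upper low probes = ⊤
      · refine ⟨Sum.inr buf', c₁ + (c₂ + (c₃ + 0)), fun fuel hf => ?_, Or.inl ⟨buf', rfl, hbuf', ?_⟩⟩
        · refine Prog.run_bind hrun₁ (Prog.run_bind hrun₂ (Prog.run_bind (hrun₃ fuel hf) ?_))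
          exact (congrArg (Prog.run B (Q.disk I)) (if_pos htop)).trans (Prog.run_pure _)
        · have := Nat.mul_le_mul_left Q.n (Finset.card_le_card hsub')
          omega
      · obtain ⟨h, hh⟩ := WithTop.ne_top_iff_exists.1 htop
        have hh' : upper low probes = (h : WithTop ℕ) := hh.symm
        obtain ⟨A, hA, hheavy⟩ := exists_heavy hp hh'
        have hlh : low ≤ h := by
          have := le_upper hp
          rw [hh'] at this
          exact Nat.cast_le.1 this
        refine ⟨Sum.inl (h + 1, buf'), c₁ + (c₂ + (c₃ + 0)), fun fuel hf => ?_,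
          Or.inr ⟨h + 1, buf', Q.n * newBox.card, rfl, Or.inl (List.ne_nil_of_mem hA), hbuf',
            potential_add_le hlh ⟨A, hA, hheavy⟩, ?_, by omega⟩⟩
        · refine Prog.run_bind hrun₁ (Prog.run_bind hrun₂ (Prog.run_bind (hrun₃ fuel hf) ?_))
          refine (congrArg (Prog.run B (Q.disk I)) (if_neg htop)).trans ?_
          rw [hh']
          exact Prog.run_pure _
        -- The box of this round has components at most `h` at dimension `i` and the remainder has
        -- at least `h + 1`, so both fit side by side in the current budget.
        · rw [← Nat.mul_add, ← Finset.card_union_of_disjoint]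
          · refine Nat.mul_le_mul_left _ (Finset.card_le_card (Finset.union_subset hsub' ?_))
            intro t ht
            rw [Finset.mem_filter] at ht ⊢
            exact ⟨ht.1, by omega⟩
          · rw [Finset.disjoint_left]
            intro t ht ht'
            have h4 := (active_of_mem_box hp hv ht hA).2.2
            rw [hh'] at h4
            have h5 : t.getD i 0 ≤ h := Nat.cast_le.1 h4
            have h6 := (Finset.mem_filter.1 ht').2
            omega
    -- The initial potential is at most `2 m D |I|`, which is less than `(2 m D + 1) |I|` since the
    -- input is nonempty.
    · have := potential_le (I := I) (D := D) hact 0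
      rw [Nat.succ_mul]
      omega
    · rintro buf' ⟨c, h1, h2, h3⟩
      refine ⟨buf', c, fun fuel hf => h1 fuel hf fuel hf, h2, ?_⟩
      simp only [Nat.zero_le, Finset.filter_true] at h3
      exact h3

end

/-! ### Arithmetic of the constants. -/

/-- The number of input tuples, up to a constant, that the memory share of an atom can hold. -/
theorem inputSize_lt_mul {n m M B S c x : ℕ} (hn : 1 ≤ n) (hm : 1 ≤ m) (hM : n * m < M / B)
    (hB : 1 ≤ B) (hS : S ≤ c * M) (hx : (M / B - 1) / n / m * B < 3 * n * x) :
    S < (24 * n * n * m * c + 1) * x := by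
  have hnm : 1 ≤ n * m := Nat.mul_le_mul hn hm
  rw [Nat.div_div_eq_div_mul] at hx
  set σ := (M / B - 1) / (n * m) with hσ
  have hσ1 : 1 ≤ σ := (Nat.one_le_div_iff (by omega)).2 (by omega)
  have h1 : M / B - 1 < n * m * (σ + 1) := by
    rw [hσ]; exact Nat.lt_mul_div_succ _ (by omega)
  have h2 : M < B * (M / B + 1) := Nat.lt_mul_div_succ _ (by omega)
  -- As `σ ≥ 1`, rounding in both divisions costs only a constant factor; `8` is generous.
  have h3 : M / B + 1 ≤ 8 * (n * m * σ) := by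
    have h5 := Nat.mul_le_mul_left (n * m) hσ1
    rw [Nat.mul_add] at h1
    omega
  have h4 : M ≤ 8 * (n * m) * (σ * B) := by
    calc M ≤ B * (M / B + 1) := h2.le
      _ ≤ B * (8 * (n * m * σ)) := Nat.mul_le_mul_left _ h3
      _ = _ := by ring
  have hx0 : 1 ≤ x := by
    by_contra h
    obtain rfl : x = 0 := by omega
    simp at hx
  calc S ≤ c * M := hS
    _ ≤ c * (8 * (n * m) * (3 * n * x)) :=
      Nat.mul_le_mul_left _ (h4.trans (Nat.mul_le_mul_left _ hx.le))
    -- A slice that overflows is nonempty; the extra `x`, which is the `+ 1` in the constant, makes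
    -- the inequality strict.
    _ < c * (8 * (n * m) * (3 * n * x)) + x := by omega
    _ = _ := by ring

/-- Unrolling the recursion gives one term `r ^ (e + 1)` for the rounds at each nesting depth. -/
theorem readCost_le (r X d : ℕ) : readCost r X d ≤ (∑ e ∈ Finset.range d, r ^ (e + 1)) * X := by
  induction d with
  | zero => simp [readCost]
  | succ d ih =>
    rw [readCost, Finset.sum_range_succ']
    calc r * (X + readCost r X d) ≤ r * (X + (∑ e ∈ Finset.range d, r ^ (e + 1)) * X) :=
        Nat.mul_le_mul_left _ (Nat.add_le_add_left ih _)
      _ = _ := by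
        rw [Nat.mul_add, ← Nat.mul_assoc, Finset.mul_sum, Nat.add_mul, Nat.add_comm]
        congr 2
        · exact Finset.sum_congr rfl fun e _ => by ring
        · ring

theorem roundCost_le (n m L S B : ℕ) (hL : 1 ≤ L) :
    roundCost n m L S B ≤ m * (20 * n + 4) * (L + (S + 1) / B) := by
  rw [roundCost]
  generalize (S + 1) / B = y
  obtain ⟨L, rfl⟩ := Nat.exists_eq_add_of_le' hL
  nlinarith [Nat.zero_le (m * n * L), Nat.zero_le (m * n * y), Nat.zero_le (m * L),
    Nat.zero_le (m * y), Nat.zero_le (m * n), Nat.zero_le m]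

/-- The logarithm of the input size and the rounding are absorbed by the number of input blocks. -/
theorem log_add_div_le {S B L : ℕ} (hB : 1 ≤ B) (hS : 2 ≤ S) (hL : L = Nat.log 2 S + 1)
    (hlog : Real.log S ≤ (S : ℝ) / B) :
    1 ≤ 2 * ((S : ℝ) / B) ∧ ((L + (S + 1) / B : ℕ) : ℝ) ≤ 6 * ((S : ℝ) / B) := by
  have hB0 : (0 : ℝ) < B := by exact_mod_cast hB
  have hS0 : (0 : ℝ) < S := by exact_mod_cast (by omega : 0 < S)
  have hln2 := Real.log_two_gt_d9
  have h1 : (Nat.log 2 S : ℝ) * Real.log 2 ≤ Real.log S := by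
    rw [← Real.log_pow]
    exact Real.log_le_log (by positivity) (by exact_mod_cast Nat.pow_log_le_self 2 (by omega))
  have h2 : Real.log 2 ≤ Real.log S :=
    Real.log_le_log (by norm_num) (by exact_mod_cast hS)
  have h3 : (((S + 1) / B : ℕ) : ℝ) ≤ ((S + 1 : ℕ) : ℝ) / B := Nat.cast_div_le
  have h4 : ((S + 1 : ℕ) : ℝ) / B ≤ 3 / 2 * ((S : ℝ) / B) := by
    rw [mul_div_assoc', div_le_div_iff_of_pos_right hB0]
    have : (2 : ℝ) ≤ S := by exact_mod_cast hS
    push_cast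
    linarith
  -- Since `ln 2 > 1/2`, both `log₂ S` and `1` are at most `2 S / B`. With `3/2` for the rounded
  -- quotient the sum stays below `6`.
  have h5 : (Nat.log 2 S : ℝ) ≤ 2 * ((S : ℝ) / B) := by
    have : (0 : ℝ) ≤ Nat.log 2 S := Nat.cast_nonneg _
    nlinarith
  refine ⟨by linarith, ?_⟩
  rw [hL]
  push_cast
  push_cast at h3 h4
  linarith

end BoxedLFTJ

/-! ### Assembly of the final bound. -/

theorem mainTheorem8 (Q : BoxedLFTJ.Query) (c : ℝ) :
    ∃ C : ℝ, ∀ (M B : ℕ) (I : Q.Input),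
      1 ≤ B →
      Q.n * Q.m < M / B →
      2 ≤ Q.inputSize I →
      Real.log (Q.inputSize I) ≤ (Q.inputSize I : ℝ) / B →
      (Q.inputSize I : ℝ) ≤ c * M →
      ∃ cost : ℕ, BoxedLFTJ.HaltsWithCost Q M B I cost ∧
        (cost : ℝ) ≤ C * ((Q.inputSize I : ℝ) / B + (Q.outputSize I : ℝ) / B) := by
  set D := 24 * Q.n * Q.n * Q.m * ⌈c⌉₊ + 1 with hD
  set E := (∑ e ∈ Finset.range Q.n, (2 * Q.m * D + 1) ^ (e + 1)) * (Q.m * (20 * Q.n + 4)) with hE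
  -- `6 E` pays for the reads, `n` for the output words, and the rest for the final flush, a single
  -- block, using `1 ≤ 2 S / B`.
  refine ⟨6 * E + Q.n + 4, fun M B I hB hM hS hlog hc => ?_⟩
  set S := Q.inputSize I with hSdef
  -- A nonempty input requires a relation symbol, hence an atom and a variable; this makes `m` and
  -- `n` positive.
  have hr : 0 < Q.r := by
    by_contra h
    have h0 : IsEmpty (Fin Q.r) := by
      rw [show Q.r = 0 by omega]; infer_instance
    rw [hSdef, BoxedLFTJ.Query.inputSize, Finset.univ_eq_empty, Finset.sum_empty] at hS
    omega
  obtain ⟨j, -⟩ := Q.rel_surj ⟨0, hr⟩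
  have hm : 1 ≤ Q.m := by have := j.2; omega
  have hn : 1 ≤ Q.n := (Q.arity_pos _).trans_le (BoxedLFTJ.Query.arity_le j)
  have hcM : S ≤ ⌈c⌉₊ * M := by
    have : (S : ℝ) ≤ ⌈c⌉₊ * M := hc.trans (mul_le_mul_of_nonneg_right (Nat.le_ceil c) (by positivity))
    exact_mod_cast this
  obtain ⟨buf, k, hrun, hbuf, hk⟩ := BoxedLFTJ.halts_boxUp (I := I) (L := Nat.log 2 S + 1)
    (D := D) (memMax := M / B - 1) hB (by omega) (Nat.lt_pow_succ_log_self (by norm_num) _)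
    ((Nat.le_div_iff_mul_le hn).2 (by rw [Nat.mul_comm]; omega))
    (fun x hx => BoxedLFTJ.inputSize_lt_mul hn hm hM hB hcM hx) Q.n 0 0 (by omega) [] [] []
    (BoxedLFTJ.inv_zero I) hB
  obtain ⟨u, k', hrun', hk'⟩ := BoxedLFTJ.Prog.halts_flushOut (disk := Q.disk I) buf hbuf.le
  refine ⟨k + k', ?_, ?_⟩
  · filter_upwards [Filter.eventually_ge_atTop (2 * Q.m * D + 1)] with fuel hf
    rw [BoxedLFTJ.Prog.cost_eq_run, BoxedLFTJ.program, BoxedLFTJ.main,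
      BoxedLFTJ.Prog.run_bind (hrun fuel hf) hrun']
    rfl
  · have hB0 : (0 : ℝ) < B := by exact_mod_cast hB
    obtain ⟨h1, h2⟩ := BoxedLFTJ.log_add_div_le hB hS rfl hlog
    have h3 : BoxedLFTJ.readCost (2 * Q.m * D + 1)
        (BoxedLFTJ.roundCost Q.n Q.m (Nat.log 2 S + 1) S B) Q.n
        ≤ E * (Nat.log 2 S + 1 + (S + 1) / B) := by
      refine (BoxedLFTJ.readCost_le _ _ _).trans ?_
      refine (Nat.mul_le_mul_left _
        (BoxedLFTJ.roundCost_le _ _ _ _ _ (Nat.le_add_left 1 _))).trans (le_of_eq ?_)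
      rw [hE]
      exact (Nat.mul_assoc _ _ _).symm
    have h4 : (BoxedLFTJ.box I [] []).card ≤ Q.outputSize I :=
      (Finset.card_filter_le _ _).trans (BoxedLFTJ.Query.card_answerLists_le Q I)
    have h5 : B * k ≤ B * (E * (Nat.log 2 S + 1 + (S + 1) / B)) + Q.n * Q.outputSize I := by
      have h6 := Nat.mul_le_mul_left B h3
      have h7 := Nat.mul_le_mul_left Q.n h4
      rw [← hSdef, List.length_nil] at hk
      omega
    have h6 : (B : ℝ) * k ≤ B * (E * ((Nat.log 2 S + 1 + (S + 1) / B : ℕ) : ℝ))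
        + Q.n * Q.outputSize I := by exact_mod_cast h5
    have h7 : (k : ℝ) ≤ E * ((Nat.log 2 S + 1 + (S + 1) / B : ℕ) : ℝ)
        + Q.n * ((Q.outputSize I : ℝ) / B) := by
      -- The balance in words becomes a bound in blocks on division by `B`.
      rw [← mul_le_mul_iff_right₀ hB0]
      refine h6.trans (le_of_eq ?_)
      field_simp
    have h8 : (E : ℝ) * ((Nat.log 2 S + 1 + (S + 1) / B : ℕ) : ℝ) ≤ E * (6 * ((S : ℝ) / B)) :=
      mul_le_mul_of_nonneg_left h2 (Nat.cast_nonneg _)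
    have h9 : (k' : ℝ) ≤ 1 := by exact_mod_cast hk'
    have h10 : (0 : ℝ) ≤ (Q.outputSize I : ℝ) / B := by positivity
    have h11 : (0 : ℝ) ≤ (E : ℝ) * ((Q.outputSize I : ℝ) / B) := by positivity
    have h12 : (0 : ℝ) ≤ (Q.n : ℝ) * ((S : ℝ) / B) := by positivity
    push_cast at *
    nlinarith
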